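/- **Theorem.** Consider the complex Gaussian three-user channel $Y_\ell=\sum_{i=1}^3 h_{\ell i}X_i+Z_\ell$, $\ell=1,2,3$, with power constraints $\mathbb E|X_i|^2\le 1$ and with proper complex Gaussian noises $Z_\ell\sim\mathcal N(0,1)$, taken independent of each other, of the inputs, and across channel uses. Assume that the channel is symmetric in the two primary users: $$h_{11}=h_{22}=|h_{\rm d}|,\qquad h_{12}=h_{21}=h_{\rm i},\qquad h_{13}=h_{23}=h_{\rm c},$$ where $h_{\rm d},h_{\rm i},h_{\rm c}$ and $h_{31},h_{32},h_{33}$ are arbitrary complex numbers with $h_{\rm c}\neq 0$. Suppose that $|h_{33}|^2\le|h_{\rm c}|^2$ and that $$\log\bigl(1+\mathbf h_2^H\mathbf\Sigma\,\mathbf h_2\bigr)\le\log\bigl(1+\mathbf h_1^H\mathbf\Sigma\,\mathbf h_1\bigr),\qquad \mathbf h_2^*=\begin{bmatrix}|h_{\rm d}|\\ h_{\rm c}\end{bmatrix},\quad \mathbf h_1^*=\begin{bmatrix}h_{\rm i}\\ h_{\rm c}\end{bmatrix},\quad \mathbf\Sigma=\begin{bmatrix}1-|\rho_1|^2&\rho_3-\rho_1\rho_2^*\\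 \rho_3^*-\rho_1^*\rho_2&1-|\rho_2|^2\end{bmatrix},$$ for all complex $\rho_1,\rho_2,\rho_3$ with $|\rho_i|\le1$ that are correlation coefficients of some unit-variance inputs, i.e. for which $\mathbf\Sigma\succeq0$. Let $$\overline C=\sup\Bigl\{I(Y_1;X_1,X_2,X_3)+I(Y_2;X_2,X_3\mid X_1,Y_1)+I(Y_3;X_3\mid X_1,X_2,Y_1,Y_2)\Bigr\}$$ (in bits), where the supremum is over all joint laws of $(X_1,X_2,X_3)$ with $\mathbb E|X_i|^2\le1$ for each $i$; this is the sum-capacity outer bound of the channel with cumulative message sharing, in which transmitter $i$ knows the messages $W_1,\dots,W_i$. Then there is a rate pair $(R_1,R_2)$ with $$\overline C\le R_1+R_2+3$$ that is achievable with the message knowledge of an interference channel with a cognitive relay: transmitters 1 and 2 know only their own messages $W_1$ and $W_2$, transmitter 3 knows $(W_1,W_2)$ and has no message of its own, receivers 1 and 2 decode $W_1$ and $W_2$ respectively, and the average error probabilities tend to $0$ as the block length $N\to\infty$, under the power constraint $\frac1N\sum_{t=1}^N\mathbb E|X_{i,t}|^2\le1$ for each transmitter. Moreover, $(R_1,R_2)$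 is achieved by codes in which transmitter 3 beamforms the primary codewords, $X_3^N=aX_1^N+bX_2^N$ with constants $a,b\in\mathbb C$ not depending on $N$, and in which receivers 1 and 2 both decode the pair $(W_1,W_2)$ with vanishing error probability, as in a compound multiple-access channel. -/

import Mathlib

open MeasureTheory ProbabilityTheory Filter Topology
open scoped ENNReal Matrix ComplexConjugate ComplexOrder

noncomputable section

namespace CIFC

/-- The law `𝒩(0,1)` of a proper (circularly symmetric) complex Gaussian random variable with mean
`0` and variance `1`: independent real and imaginary parts, each of variance `1/2`. -/
def stdComplexGaussian : Measure ℂ :=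
  ((gaussianReal 0 (1 / 2)).prod (gaussianReal 0 (1 / 2))).map
    (fun p : ℝ × ℝ => (p.1 : ℂ) + (p.2 : ℂ) * Complex.I)

instance : IsProbabilityMeasure stdComplexGaussian := by
  unfold stdComplexGaussian
  exact Measure.isProbabilityMeasure_map (by fun_prop)

/-- Channel matrix of the symmetric three-user Gaussian channel; the entry in row `ℓ` and column
`i` is the gain from transmitter `i` to receiver `ℓ` (indices `0, 1, 2` for users `1, 2, 3`).
The gains into the cognitive receiver (last row) are arbitrary. -/
def symmetricGains (hd hi hc h31 h32 h33 : ℂ) : Matrix (Fin 3) (Fin 3) ℂ :=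
  !![(‖hd‖ : ℂ), hi, hc;
     hi, (‖hd‖ : ℂ), hc;
     h31, h32, h33]

/-! ### Mutual information, in bits -/

section Information

variable {Ω α β γ : Type*} [MeasurableSpace Ω] [MeasurableSpace α] [MeasurableSpace β]
  [MeasurableSpace γ]

/-- `I(A; B)` in bits. -/
def mutualInfo (A : Ω → α) (B : Ω → β) (μ : Measure Ω) : ℝ≥0∞ :=
  InformationTheory.klDiv (μ.map (fun ω => (A ω, B ω))) ((μ.map A).prod (μ.map B))
    / ENNReal.ofReal (Real.log 2)

/-- `I(A; B | C)` in bits: the divergence of the joint law of `(C, A, B)` from the law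
`P_C P_{A|C} P_{B|C}` under which `A` and `B` are conditionally independent given `C`. -/
def condMutualInfo [StandardBorelSpace α] [Nonempty α] [StandardBorelSpace β] [Nonempty β]
    (A : Ω → α) (B : Ω → β) (C : Ω → γ) (μ : Measure Ω) [IsFiniteMeasure μ] : ℝ≥0∞ :=
  InformationTheory.klDiv (μ.map (fun ω => (C ω, A ω, B ω)))
      ((μ.map C) ⊗ₘ (condDistrib A C μ ×ₖ condDistrib B C μ))
    / ENNReal.ofReal (Real.log 2)

end Information

/-! ### The sum-capacity outer bound for cumulative message sharing -/

/-- Law of inputs and noises `(X, Z)` in one channel use: `X ~ P`, and `Z` is independent of `X`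
with i.i.d. `𝒩(0,1)` components. -/
def inputNoiseLaw (P : Measure (Fin 3 → ℂ)) : Measure ((Fin 3 → ℂ) × (Fin 3 → ℂ)) :=
  P.prod (Measure.pi fun _ => stdComplexGaussian)

instance (P : Measure (Fin 3 → ℂ)) [IsProbabilityMeasure P] :
    IsProbabilityMeasure (inputNoiseLaw P) := by
  unfold inputNoiseLaw; infer_instance

/-- The channel input `X_i`. -/
def inputX (i : Fin 3) (ω : (Fin 3 → ℂ) × (Fin 3 → ℂ)) : ℂ := ω.1 i

/-- The channel output `Y_ℓ = ∑ i, h_{ℓ i} X_i + Z_ℓ`. -/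
def outputY (H : Matrix (Fin 3) (Fin 3) ℂ) (l : Fin 3) (ω : (Fin 3 → ℂ) × (Fin 3 → ℂ)) : ℂ :=
  ∑ i, H l i * ω.1 i + ω.2 l

/-- The right-hand side of the sum-rate bound, for the joint input law `P`:
`I(Y₁; X₁,X₂,X₃) + I(Y₂; X₂,X₃ | X₁,Y₁) + I(Y₃; X₃ | X₁,X₂,Y₁,Y₂)`. -/
def cmsSumRateBound (H : Matrix (Fin 3) (Fin 3) ℂ) (P : Measure (Fin 3 → ℂ))
    [IsProbabilityMeasure P] : ℝ≥0∞ :=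
  mutualInfo (outputY H 0) (fun ω => (inputX 0 ω, inputX 1 ω, inputX 2 ω)) (inputNoiseLaw P)
  + condMutualInfo (outputY H 1) (fun ω => (inputX 1 ω, inputX 2 ω))
      (fun ω => (inputX 0 ω, outputY H 0 ω)) (inputNoiseLaw P)
  + condMutualInfo (outputY H 2) (inputX 2)
      (fun ω => (inputX 0 ω, inputX 1 ω, outputY H 0 ω, outputY H 1 ω)) (inputNoiseLaw P)

/-- The sum-capacity outer bound of the three-user channel with cumulative message sharing: the
sum-rate bound, maximized over all joint input laws with `E|X_i|² ≤ 1`. -/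
def cmsSumCapacityOuterBound (H : Matrix (Fin 3) (Fin 3) ℂ) : ℝ≥0∞ :=
  ⨆ (P : Measure (Fin 3 → ℂ)) (_ : IsProbabilityMeasure P)
    (_ : ∀ i, ∫⁻ x, ENNReal.ofReal (‖x i‖ ^ 2) ∂P ≤ 1), cmsSumRateBound H P

/-! ### Codes with the message knowledge of the interference channel with a cognitive relay -/

/-- Block output of receiver `l` for block inputs `x` and noise block `z`. -/
def received {N : ℕ} (H : Matrix (Fin 3) (Fin 3) ℂ) (l : Fin 3) (x : Fin 3 → Fin N → ℂ)
    (z : Fin N → ℂ) : Fin N → ℂ :=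
  fun t => ∑ i, H l i * x i t + z t

/-- A block of `N` i.i.d. `𝒩(0,1)` noises. -/
def blockNoise (N : ℕ) : Measure (Fin N → ℂ) := Measure.pi fun _ => stdComplexGaussian

/-- A code of block length `N` with IFC+CR message knowledge: transmitters 1 and 2 each know
their own message only, transmitter 3 has no message of its own and knows both, and receivers
1 and 2 each estimate their own message. -/
structure IFCCRCode (N M₁ M₂ : ℕ) where
  enc₁ : Fin M₁ → Fin N → ℂ
  enc₂ : Fin M₂ → Fin N → ℂ
  enc₃ : Fin M₁ → Fin M₂ → Fin N → ℂ
  dec₁ : (Fin N → ℂ) → Fin M₁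
  dec₂ : (Fin N → ℂ) → Fin M₂
  measurable_dec₁ : Measurable dec₁
  measurable_dec₂ : Measurable dec₂

namespace IFCCRCode

variable {N M₁ M₂ : ℕ}

/-- The three transmitted blocks for the message pair `(w₁, w₂)`. -/
def input (c : IFCCRCode N M₁ M₂) (w₁ : Fin M₁) (w₂ : Fin M₂) : Fin 3 → Fin N → ℂ :=
  ![c.enc₁ w₁, c.enc₂ w₂, c.enc₃ w₁ w₂]

/-- `(1/N) ∑ t, E|X_{i,t}|² ≤ 1` for each transmitter `i`, with the expectation over independent
uniform messages. -/
def PowerConstraint (c : IFCCRCode N M₁ M₂) : Prop :=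
  ∀ i, ∑ w₁, ∑ w₂, ∑ t, ‖c.input w₁ w₂ i t‖ ^ 2 ≤ (N : ℝ) * (M₁ * M₂)

/-- `ℙ[Ŵ₁ ≠ W₁]`, averaged over independent uniform messages. -/
def error₁ (H : Matrix (Fin 3) (Fin 3) ℂ) (c : IFCCRCode N M₁ M₂) : ℝ :=
  (∑ w₁, ∑ w₂, (blockNoise N).real {z | c.dec₁ (received H 0 (c.input w₁ w₂) z) ≠ w₁})
    / ((M₁ : ℝ) * M₂)

/-- `ℙ[Ŵ₂ ≠ W₂]`, averaged over independent uniform messages. -/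
def error₂ (H : Matrix (Fin 3) (Fin 3) ℂ) (c : IFCCRCode N M₁ M₂) : ℝ :=
  (∑ w₁, ∑ w₂, (blockNoise N).real {z | c.dec₂ (received H 1 (c.input w₁ w₂) z) ≠ w₂})
    / ((M₁ : ℝ) * M₂)

end IFCCRCode

/-- Number of messages at rate `R` bits per channel use and block length `N`. -/
def numMessages (N : ℕ) (R : ℝ) : ℕ := ⌈(2 : ℝ) ^ ((N : ℝ) * R)⌉₊

/-- `(R₁, R₂)` is an achievable rate pair with IFC+CR message knowledge. -/
def IFCCRAchievable (H : Matrix (Fin 3) (Fin 3) ℂ) (R₁ R₂ : ℝ) : Prop :=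
  0 ≤ R₁ ∧ 0 ≤ R₂ ∧
    ∃ c : ∀ N : ℕ, IFCCRCode N (numMessages N R₁) (numMessages N R₂),
      (∀ N, (c N).PowerConstraint) ∧
      Tendsto (fun N => max ((c N).error₁ H) ((c N).error₂ H)) atTop (𝓝 0)

/-- A code in which transmitter 3 beamforms the primary codewords, sending
`a X₁ + b X₂`, and in which receivers 1 and 2 both decode both messages
(a compound multiple-access channel). -/
structure BeamformingCode (N M₁ M₂ : ℕ) where
  enc₁ : Fin M₁ → Fin N → ℂ
  enc₂ : Fin M₂ → Fin N → ℂ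
  dec₁ : (Fin N → ℂ) → Fin M₁ × Fin M₂
  dec₂ : (Fin N → ℂ) → Fin M₁ × Fin M₂
  measurable_dec₁ : Measurable dec₁
  measurable_dec₂ : Measurable dec₂

namespace BeamformingCode

variable {N M₁ M₂ : ℕ}

/-- The underlying code with IFC+CR message knowledge. -/
def toIFCCR (c : BeamformingCode N M₁ M₂) (a b : ℂ) : IFCCRCode N M₁ M₂ where
  enc₁ := c.enc₁
  enc₂ := c.enc₂
  enc₃ := fun w₁ w₂ t => a * c.enc₁ w₁ t + b * c.enc₂ w₂ t
  dec₁ := fun y => (c.dec₁ y).1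
  dec₂ := fun y => (c.dec₂ y).2
  measurable_dec₁ := c.measurable_dec₁.fst
  measurable_dec₂ := c.measurable_dec₂.snd

/-- Average probability that receiver 1 does not recover the pair `(W₁, W₂)`. -/
def jointError₁ (H : Matrix (Fin 3) (Fin 3) ℂ) (c : BeamformingCode N M₁ M₂) (a b : ℂ) : ℝ :=
  (∑ w₁, ∑ w₂, (blockNoise N).real
      {z | c.dec₁ (received H 0 ((c.toIFCCR a b).input w₁ w₂) z) ≠ (w₁, w₂)})
    / ((M₁ : ℝ) * M₂)

/-- Average probability that receiver 2 does not recover the pair `(W₁, W₂)`. -/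
def jointError₂ (H : Matrix (Fin 3) (Fin 3) ℂ) (c : BeamformingCode N M₁ M₂) (a b : ℂ) : ℝ :=
  (∑ w₁, ∑ w₂, (blockNoise N).real
      {z | c.dec₂ (received H 1 ((c.toIFCCR a b).input w₁ w₂) z) ≠ (w₁, w₂)})
    / ((M₁ : ℝ) * M₂)

end BeamformingCode

/-- `(R₁, R₂)` is achieved by beamforming the primary codewords at transmitter 3, with weights
that do not depend on the block length, and compound-MAC decoding at receivers 1 and 2. -/
def BeamformingAchievable (H : Matrix (Fin 3) (Fin 3) ℂ) (R₁ R₂ : ℝ) : Prop :=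
  0 ≤ R₁ ∧ 0 ≤ R₂ ∧
    ∃ (a b : ℂ) (c : ∀ N : ℕ, BeamformingCode N (numMessages N R₁) (numMessages N R₂)),
      (∀ N, ((c N).toIFCCR a b).PowerConstraint) ∧
      Tendsto (fun N => max ((c N).jointError₁ H a b) ((c N).jointError₂ H a b)) atTop (𝓝 0)

/-! ### The strong-interference condition -/

/-- Conditional covariance of `(X₂, X₃)` given `X₁` for unit-variance jointly Gaussian inputs with
`ρ₁ = E[X₂ X₁*]`, `ρ₂ = E[X₃ X₁*]`, `ρ₃ = E[X₂ X₃*]`. -/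
def condCov (ρ₁ ρ₂ ρ₃ : ℂ) : Matrix (Fin 2) (Fin 2) ℂ :=
  !![1 - (‖ρ₁‖ : ℂ) ^ 2, ρ₃ - ρ₁ * conj ρ₂;
     conj ρ₃ - conj ρ₁ * ρ₂, 1 - (‖ρ₂‖ : ℂ) ^ 2]

/-- The real number `hᴴ S h` (for Hermitian `S`), where `h* = (u, v)`. -/
def quadForm (S : Matrix (Fin 2) (Fin 2) ℂ) (u v : ℂ) : ℝ :=
  (![u, v] ⬝ᵥ (S *ᵥ star ![u, v])).re

/-- The strong-interference condition
`log (1 + h₂ᴴ Σ h₂) ≤ log (1 + h₁ᴴ Σ h₁)` with `h₂* = (|h_d|, h_c)` and `h₁* = (h_i, h_c)`, for all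
correlation parameters. Positive semidefiniteness of `Σ` says that the `ρ`'s are the correlations
of some triple of unit-variance inputs. -/
def StrongInterference (hd hi hc : ℂ) : Prop :=
  ∀ ρ₁ ρ₂ ρ₃ : ℂ, ‖ρ₁‖ ≤ 1 → ‖ρ₂‖ ≤ 1 → ‖ρ₃‖ ≤ 1 → (condCov ρ₁ ρ₂ ρ₃).PosSemidef →
    Real.logb 2 (1 + quadForm (condCov ρ₁ ρ₂ ρ₃) (‖hd‖ : ℂ) hc) ≤
      Real.logb 2 (1 + quadForm (condCov ρ₁ ρ₂ ρ₃) hi hc)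

end CIFC

end

/-! The strong-interference condition is far more rigid than it looks. Take inputs for which the
conditional covariance of (X₂, X₃) given X₁ has rank one, spanned by (w, 1). The condition then
reads |d w + h_c| ≤ |h_i w + h_c| with d = |h_d|, for all |w| ≤ 1. As w → 0 the linear terms
dominate; since h_c ≠ 0 and the phase of w is free, they force h_i = d (`StrongInterference.eq`).
Receivers 1 and 2 therefore see the same signal and differ only in their noises.

Converse (`cmsSumCapacityOuterBound_le`). Each mutual information is bounded by comparing the output
with a Gaussian centred at an estimate computed from the conditioning variables
(`condMutualInfo_le_of_add_noise`). With estimate 0, the first term is at most log₂(1 + (2d +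
|h_c|)²). Given Y₁, the signal in Y₂ is known up to the unit-variance noise Z₁, so the second term
is at most 1 bit. Given X₁, X₂ and Y₁, the signal in Y₃ is known up to (h₃₃/h_c) Z₁, whose variance
is at most 1, so the third term is at most 1 bit. No Gaussian optimality argument is needed.

Achievability (`beamformingAchievable_of_lt`). The primary users transmit in disjoint halves of the
block, each with doubled power, and the relay always amplifies the active codeword in phase. Both
receivers then see a point-to-point channel, and every sum rate below log₂(1 + (√2 d + |h_c|)²) is
achieved; the point-to-point codes come from Feinstein's maximal construction
(`eventually_exists_gaussian_code`).

Finally 1 + (2d + |h_c|)² < 2 (1 + (√2 d + |h_c|)²), so the two logarithms differ by less than one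
bit. Together with the two bits of the converse this gives the gap of 3. -/

open scoped NNReal

noncomputable section

namespace CIFC

/-! ### Complex Gaussian measures -/

/-- The centred proper complex Gaussian law of variance `v`. -/
def complexGaussian (v : ℝ≥0) : Measure ℂ :=
  ((gaussianReal 0 (v / 2)).prod (gaussianReal 0 (v / 2))).map
    (fun p : ℝ × ℝ => (p.1 : ℂ) + (p.2 : ℂ) * Complex.I)

instance (v : ℝ≥0) : IsProbabilityMeasure (complexGaussian v) := by
  unfold complexGaussian
  exact Measure.isProbabilityMeasure_map (by fun_prop)

lemma complexGaussian_one : complexGaussian 1 = stdComplexGaussian := rfl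

lemma lintegral_complexGaussian (v : ℝ≥0) {F : ℂ → ℝ≥0∞} (hF : Measurable F) :
    ∫⁻ z, F z ∂complexGaussian v =
      ∫⁻ x, ∫⁻ y, F ((x : ℂ) + (y : ℂ) * Complex.I) ∂gaussianReal 0 (v / 2)
        ∂gaussianReal 0 (v / 2) := by
  rw [complexGaussian, lintegral_map hF (by fun_prop), lintegral_prod _ (by fun_prop)]

/-- The density of the proper complex Gaussian law of mean `m` and variance `v`. -/
def complexGaussianPDF (m : ℂ) (v : ℝ) (z : ℂ) : ℝ :=
  (Real.pi * v)⁻¹ * Real.exp (-‖z - m‖ ^ 2 / v)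

@[fun_prop]
lemma measurable_complexGaussianPDF {α : Type*} [MeasurableSpace α] {f g : α → ℂ} {v : ℝ}
    (hf : Measurable f) (hg : Measurable g) :
    Measurable (fun a => complexGaussianPDF (f a) v (g a)) := by
  unfold complexGaussianPDF
  fun_prop

lemma complexGaussianPDF_pos (m : ℂ) {v : ℝ} (hv : 0 < v) (z : ℂ) :
    0 < complexGaussianPDF m v z := by
  unfold complexGaussianPDF; positivity

lemma norm_sq_add_mul_I (x y : ℝ) : ‖(x : ℂ) + (y : ℂ) * Complex.I‖ ^ 2 = x ^ 2 + y ^ 2 := by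
  rw [← Complex.normSq_eq_norm_sq, Complex.normSq_add_mul_I]

lemma gaussianPDF_mul_gaussianPDF (v : ℝ≥0) (x y : ℝ) :
    gaussianPDF 0 (v / 2) x * gaussianPDF 0 (v / 2) y =
      ENNReal.ofReal (complexGaussianPDF 0 v ((x : ℂ) + (y : ℂ) * Complex.I)) := by
  rw [gaussianPDF, gaussianPDF, ← ENNReal.ofReal_mul (gaussianPDFReal_nonneg _ _ _)]
  congr 1
  simp only [gaussianPDFReal, complexGaussianPDF, sub_zero, norm_sq_add_mul_I]
  have h2 : (2 * ((v / 2 : ℝ≥0) : ℝ)) = v := by push_cast; ring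
  have h3 : 2 * Real.pi * ((v / 2 : ℝ≥0) : ℝ) = Real.pi * v := by push_cast; ring
  rw [h2, h3, mul_mul_mul_comm, ← Real.exp_add, ← mul_inv, Real.mul_self_sqrt (by positivity)]
  congr 2
  ring

lemma complexGaussian_eq_withDensity {v : ℝ≥0} (hv : v ≠ 0) :
    complexGaussian v =
      volume.withDensity (fun z => ENNReal.ofReal (complexGaussianPDF 0 v z)) := by
  have hv2 : v / 2 ≠ 0 := by positivity
  ext s hs
  rw [← lintegral_indicator_one hs, lintegral_complexGaussian _ (measurable_one.indicator hs),
    withDensity_apply _ hs, ← lintegral_indicator hs,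
    ← (Complex.volume_preserving_equiv_real_prod.symm _).lintegral_comp
      (Measurable.indicator (by fun_prop) hs), Measure.volume_eq_prod,
    lintegral_prod _ (by
      refine Measurable.aemeasurable ?_
      exact (Measurable.indicator (by fun_prop) hs).comp
        Complex.measurableEquivRealProd.symm.measurable)]
  have hm : Measurable (fun p : ℝ × ℝ =>
      s.indicator (1 : ℂ → ℝ≥0∞) ((p.1 : ℂ) + (p.2 : ℂ) * Complex.I)) :=
    (measurable_one.indicator hs).comp (by fun_prop)
  rw [gaussianReal_of_var_ne_zero _ hv2, lintegral_withDensity_eq_lintegral_mul _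
    (measurable_gaussianPDF _ _)]
  · refine lintegral_congr fun x => ?_
    simp only [Pi.mul_apply]
    have hmx : Measurable (fun y : ℝ =>
        s.indicator (1 : ℂ → ℝ≥0∞) ((x : ℂ) + (y : ℂ) * Complex.I)) :=
      hm.comp measurable_prodMk_left
    rw [lintegral_withDensity_eq_lintegral_mul _ (measurable_gaussianPDF _ _) hmx,
      ← lintegral_const_mul _ ((measurable_gaussianPDF _ _).mul hmx)]
    refine lintegral_congr fun y => ?_
    simp only [Pi.mul_apply, ← mul_assoc, gaussianPDF_mul_gaussianPDF]
    have : Complex.measurableEquivRealProd.symm (x, y) = (x : ℂ) + (y : ℂ) * Complex.I := by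
      apply Complex.ext <;> simp [Complex.measurableEquivRealProd]
    by_cases h : (x : ℂ) + (y : ℂ) * Complex.I ∈ s <;> simp [this, h]
  · exact hm.lintegral_prod_right'

lemma lintegral_complexGaussianPDF (m : ℂ) {v : ℝ} (hv : 0 < v) :
    ∫⁻ z, ENNReal.ofReal (complexGaussianPDF m v z) = 1 := by
  have h0 : ∫⁻ z, ENNReal.ofReal (complexGaussianPDF 0 v z) = 1 := by
    lift v to ℝ≥0 using hv.le
    have := measure_univ (μ := complexGaussian v)
    rwa [complexGaussian_eq_withDensity (by exact_mod_cast hv.ne'), withDensity_apply _ .univ,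
      setLIntegral_univ] at this
  rw [← h0, ← lintegral_sub_right_eq_self (fun z => ENNReal.ofReal (complexGaussianPDF 0 v z)) m]
  simp [complexGaussianPDF]

/-- Shifting `stdComplexGaussian` by `m` gives the law with density `complexGaussianPDF m 1`. -/
lemma lintegral_stdComplexGaussian_add (m : ℂ) {F : ℂ → ℝ≥0∞} (hF : Measurable F) :
    ∫⁻ z, F (m + z) ∂stdComplexGaussian =
      ∫⁻ y, F y * ENNReal.ofReal (complexGaussianPDF m 1 y) := by
  rw [← complexGaussian_one, complexGaussian_eq_withDensity one_ne_zero,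
    lintegral_withDensity_eq_lintegral_mul _ (by fun_prop) (by fun_prop),
    ← lintegral_sub_right_eq_self _ m]
  refine lintegral_congr fun z => ?_
  simp [complexGaussianPDF, mul_comm]

/-- Real and imaginary parts convolve separately. Applied coordinatewise, this identifies the output
law when a Gaussian random codeword meets the noise. -/
lemma lintegral_complexGaussian_add (v w : ℝ≥0) {F : ℂ → ℝ≥0∞} (hF : Measurable F) :
    ∫⁻ x, ∫⁻ y, F (x + y) ∂complexGaussian w ∂complexGaussian v =
      ∫⁻ z, F z ∂complexGaussian (v + w) := by
  have hconv : ∀ {G : ℝ → ℝ≥0∞}, Measurable G →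
      ∫⁻ a, G a ∂gaussianReal 0 ((v + w) / 2) =
        ∫⁻ a, ∫⁻ b, G (a + b) ∂gaussianReal 0 (w / 2) ∂gaussianReal 0 (v / 2) := by
    intro G hG
    have : gaussianReal 0 ((v + w) / 2) = gaussianReal 0 (v / 2) ∗ gaussianReal 0 (w / 2) := by
      rw [gaussianReal_conv_gaussianReal, add_zero, add_div]
    rw [this, Measure.lintegral_conv hG]
  rw [lintegral_complexGaussian _ hF, hconv (Measurable.lintegral_prod_right' (f := fun p : ℝ × ℝ =>
      F ((p.1 : ℂ) + (p.2 : ℂ) * Complex.I)) (by fun_prop)),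
    lintegral_complexGaussian _ (Measurable.lintegral_prod_right' (f := fun p : ℂ × ℂ =>
      F (p.1 + p.2)) (by fun_prop))]
  refine lintegral_congr fun a => ?_
  have hstep : ∀ b : ℝ, ∫⁻ y, F ((a : ℂ) + (b : ℂ) * Complex.I + y) ∂complexGaussian w =
      ∫⁻ a', ∫⁻ b', F (((a + a' : ℝ) : ℂ) + ((b + b' : ℝ) : ℂ) * Complex.I)
        ∂gaussianReal 0 (w / 2) ∂gaussianReal 0 (w / 2) := by
    intro b
    rw [lintegral_complexGaussian _ (by fun_prop)]
    refine lintegral_congr fun a' => lintegral_congr fun b' => ?_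
    congr 1
    push_cast
    ring
  simp_rw [hstep]
  rw [lintegral_lintegral_swap]
  · refine lintegral_congr fun a' => ?_
    rw [hconv (G := fun y => F (((a + a' : ℝ) : ℂ) + (y : ℂ) * Complex.I)) (by fun_prop)]
  · refine Measurable.aemeasurable ?_
    exact Measurable.lintegral_prod_right' (f := fun p : (ℝ × ℝ) × ℝ =>
      F (((a + p.1.2 : ℝ) : ℂ) + ((p.1.1 + p.2 : ℝ) : ℂ) * Complex.I)) (by fun_prop)

lemma memLp_norm_sq_complexGaussian (v : ℝ≥0) :
    MemLp (fun z : ℂ => ‖z‖ ^ 2) 2 (complexGaussian v) := by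
  have hsq : MemLp (fun x : ℝ => x ^ 2) 2 (gaussianReal 0 (v / 2)) := by
    have h4 : MemLp (id : ℝ → ℝ) 4 (gaussianReal 0 (v / 2)) :=
      memLp_id_gaussianReal' 4 (by simp)
    have := h4.norm_rpow_div (q := 2)
    have h42 : (4 : ℝ≥0∞) / 2 = 2 := by
      rw [show (4 : ℝ≥0∞) = 2 * 2 by norm_num]
      exact ENNReal.mul_div_cancel_right (by simp) (by simp)
    rw [h42] at this
    simpa using this
  rw [complexGaussian, memLp_map_measure_iff (by fun_prop) (by fun_prop)]
  have : (fun z : ℂ => ‖z‖ ^ 2) ∘ (fun p : ℝ × ℝ => (p.1 : ℂ) + (p.2 : ℂ) * Complex.I) =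
      fun p => p.1 ^ 2 + p.2 ^ 2 := by
    ext p; exact norm_sq_add_mul_I _ _
  rw [this]
  exact (hsq.comp_measurePreserving measurePreserving_fst).add
    (hsq.comp_measurePreserving measurePreserving_snd)

lemma integral_norm_sq_complexGaussian (v : ℝ≥0) :
    ∫ z, ‖z‖ ^ 2 ∂complexGaussian v = v := by
  have hi : Integrable (fun x : ℝ => x ^ 2) (gaussianReal 0 (v / 2)) :=
    (memLp_id_gaussianReal' 2 (by simp)).integrable_sq
  have hm : ∫ x, x ^ 2 ∂gaussianReal 0 (v / 2) = v / 2 := by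
    have h := variance_id_gaussianReal (μ := 0) (v := v / 2)
    rw [variance_eq_integral (by fun_prop)] at h
    simpa using h
  rw [complexGaussian, integral_map (by fun_prop) (by fun_prop)]
  simp_rw [norm_sq_add_mul_I]
  rw [integral_add (hi.comp_fst _) (hi.comp_snd _), integral_fun_fst (fun x : ℝ => x ^ 2),
    integral_fun_snd (fun x : ℝ => x ^ 2), hm]
  simp

/-! ### Upper bounds on mutual information -/

section Divergence

variable {Ω α β γ : Type*} [MeasurableSpace Ω] [MeasurableSpace α] [MeasurableSpace β]
  [MeasurableSpace γ]

/-- The log-likelihood ratio is `l` almost everywhere, and the mass corrections in `klDiv` cancel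
between probability measures. -/
lemma klDiv_withDensity_exp {μ ν : Measure α} [IsProbabilityMeasure μ] [IsProbabilityMeasure ν]
    {l : α → ℝ} (hl : Measurable l)
    (hμ : μ = ν.withDensity (fun x => ENNReal.ofReal (Real.exp (l x)))) (h_int : Integrable l μ) :
    InformationTheory.klDiv μ ν = ENNReal.ofReal (∫ x, l x ∂μ) := by
  have hac : μ ≪ ν := hμ ▸ withDensity_absolutelyContinuous _ _
  have hllr : llr μ ν =ᵐ[μ] l := by
    refine hac.ae_eq ?_
    have := Measure.rnDeriv_withDensity ν
      (f := fun x => ENNReal.ofReal (Real.exp (l x))) (by fun_prop)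
    rw [← hμ] at this
    filter_upwards [this] with x hx
    rw [llr, hx, ENNReal.toReal_ofReal (Real.exp_nonneg _), Real.log_exp]
  rw [InformationTheory.klDiv_of_ac_of_integrable hac ((integrable_congr hllr).2 h_int),
    integral_congr_ae hllr]
  simp

lemma klDiv_map_equiv {μ ν : Measure α} [IsFiniteMeasure μ] [IsFiniteMeasure ν] (e : α ≃ᵐ β) :
    InformationTheory.klDiv (μ.map e) (ν.map e) = InformationTheory.klDiv μ ν := by
  refine le_antisymm (InformationTheory.klDiv_map_le _ _ e.measurable) ?_
  have h := InformationTheory.klDiv_map_le (μ.map e) (ν.map e) e.symm.measurable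
  simpa [Measure.map_map e.symm.measurable e.measurable] using h

/-- Regrouping (C, A, B) as ((C, A), B) turns conditional independence into a kernel for B that
ignores A, which is the form the chain rule for divergence needs. -/
lemma compProd_prod_map_prodAssoc_symm (P : Measure γ) [IsFiniteMeasure P] (κ : Kernel γ α)
    [IsMarkovKernel κ] (η : Kernel γ β) [IsMarkovKernel η] :
    (P ⊗ₘ (κ ×ₖ η)).map MeasurableEquiv.prodAssoc.symm = (P ⊗ₘ κ) ⊗ₘ (η.prodMkRight α) := by
  refine Measure.ext_of_lintegral _ fun F hF => ?_
  rw [lintegral_map hF (by fun_prop), Measure.lintegral_compProd (by fun_prop),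
    Measure.lintegral_compProd hF, Measure.lintegral_compProd (by
      exact Measurable.lintegral_kernel_prod_right' hF)]
  refine lintegral_congr fun c => ?_
  rw [Kernel.lintegral_prod _ _ _ (by fun_prop)]
  rfl

/-- Replacing the conditional law of `A` given `C` by any other kernel increases the divergence
that defines the conditional mutual information. -/
lemma klDiv_condDistrib_le [StandardBorelSpace α] [Nonempty α] [StandardBorelSpace β] [Nonempty β]
    {A : Ω → α} {B : Ω → β} {C : Ω → γ} (hA : Measurable A) (hB : Measurable B)
    (hC : Measurable C) (μ : Measure Ω) [IsProbabilityMeasure μ] (Q : Kernel γ α)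
    [IsMarkovKernel Q] :
    InformationTheory.klDiv (μ.map (fun ω => (C ω, A ω, B ω)))
        ((μ.map C) ⊗ₘ (condDistrib A C μ ×ₖ condDistrib B C μ)) ≤
      InformationTheory.klDiv (μ.map (fun ω => (C ω, A ω, B ω)))
        ((μ.map C) ⊗ₘ (Q ×ₖ condDistrib B C μ)) := by
  have : IsProbabilityMeasure (μ.map C) := Measure.isProbabilityMeasure_map hC.aemeasurable
  have : IsProbabilityMeasure (μ.map (fun ω => (C ω, A ω))) :=
    Measure.isProbabilityMeasure_map (by fun_prop)
  have : IsProbabilityMeasure (μ.map (fun ω => (C ω, A ω, B ω))) :=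
    Measure.isProbabilityMeasure_map (by fun_prop)
  have hjoint : (μ.map (fun ω => (C ω, A ω, B ω))).map MeasurableEquiv.prodAssoc.symm =
      μ.map (fun ω => (C ω, A ω)) ⊗ₘ condDistrib B (fun ω => (C ω, A ω)) μ := by
    rw [compProd_map_condDistrib hB.aemeasurable, Measure.map_map (by fun_prop) (by fun_prop)]
    rfl
  -- By the chain rule the right-hand side is the divergence of P_{CA} from P_C Q plus exactly the
  -- left-hand side.
  rw [← klDiv_map_equiv MeasurableEquiv.prodAssoc.symm,
    ← klDiv_map_equiv (ν := (μ.map C) ⊗ₘ (Q ×ₖ condDistrib B C μ))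
      MeasurableEquiv.prodAssoc.symm,
    compProd_prod_map_prodAssoc_symm, compProd_prod_map_prodAssoc_symm,
    compProd_map_condDistrib hA.aemeasurable, hjoint,
    InformationTheory.klDiv_compProd_eq_add (ν := (μ.map C) ⊗ₘ Q)]
  exact le_add_self

lemma condDistrib_unit_apply [StandardBorelSpace α] [Nonempty α] {A : Ω → α} (hA : Measurable A)
    {μ : Measure Ω} [IsProbabilityMeasure μ] :
    condDistrib A (fun _ => ()) μ () = μ.map A := by
  have h := congrArg (Measure.map Prod.snd)
    (compProd_map_condDistrib (X := fun _ : Ω => ()) (μ := μ) hA.aemeasurable)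
  rw [Measure.map_map (by fun_prop) (by fun_prop), ← Measure.snd, Measure.snd_compProd,
    Measure.map_const, measure_univ, one_smul, Measure.dirac_bind (by fun_prop)] at h
  exact h

/-- Data processing under the projection that forgets the trivial conditioning variable; it lets the
unconditional term use the conditional bound. -/
lemma mutualInfo_le_condMutualInfo_const [StandardBorelSpace α] [Nonempty α]
    [StandardBorelSpace β] [Nonempty β] {A : Ω → α} {B : Ω → β} (hA : Measurable A)
    (hB : Measurable B) (μ : Measure Ω) [IsProbabilityMeasure μ] :
    mutualInfo A B μ ≤ condMutualInfo A B (fun _ => ()) μ := by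
  have : IsProbabilityMeasure (μ.map (fun ω => ((), A ω, B ω))) :=
    Measure.isProbabilityMeasure_map (by fun_prop)
  have : IsProbabilityMeasure (μ.map (fun _ : Ω => ())) :=
    Measure.isProbabilityMeasure_map (by fun_prop)
  unfold mutualInfo condMutualInfo
  refine ENNReal.div_le_div_right ?_ _
  convert InformationTheory.klDiv_map_le _ _ (measurable_snd (α := Unit) (β := α × β)) using 2
  · rw [Measure.map_map (by fun_prop) (by fun_prop)]
    rfl
  · rw [← Measure.snd, Measure.snd_compProd, Measure.map_const, measure_univ, one_smul,
      Measure.dirac_bind (by fun_prop), Kernel.prod_apply, condDistrib_unit_apply hA,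
      condDistrib_unit_apply hB]
  · exact inferInstanceAs (IsFiniteMeasure (μ.map (fun ω => ((), A ω, B ω))))
  · infer_instance

/-- The Markov kernel sending `c` to the proper complex Gaussian law of mean `m c` and
variance `v`. -/
def gaussianKernel (m : γ → ℂ) (v : ℝ) : Kernel γ ℂ :=
  Kernel.withDensity (Kernel.const γ volume)
    (fun c y => ENNReal.ofReal (complexGaussianPDF (m c) v y))

lemma isMarkovKernel_gaussianKernel {m : γ → ℂ} (hm : Measurable m) {v : ℝ} (hv : 0 < v) :
    IsMarkovKernel (gaussianKernel m v) := by
  refine ⟨fun c => ⟨?_⟩⟩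
  rw [gaussianKernel, Kernel.withDensity_apply' _ (by fun_prop), setLIntegral_univ,
    Kernel.const_apply, lintegral_complexGaussianPDF _ hv]

lemma lintegral_gaussianKernel {m : γ → ℂ} (hm : Measurable m) (v : ℝ) (c : γ)
    {F : ℂ → ℝ≥0∞} (hF : Measurable F) :
    ∫⁻ y, F y ∂gaussianKernel m v c =
      ∫⁻ y, ENNReal.ofReal (complexGaussianPDF (m c) v y) * F y := by
  rw [gaussianKernel, Kernel.lintegral_withDensity _ (by fun_prop) _ hF, Kernel.const_apply]

/-- The logarithm of the ratio of the Gaussian densities of means `s, m` and variances `1, v`. -/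
lemma complexGaussianPDF_one_eq_mul_exp (s m y : ℂ) {v : ℝ} (hv : 0 < v) :
    complexGaussianPDF m v y * Real.exp (Real.log v - ‖y - s‖ ^ 2 + ‖y - m‖ ^ 2 / v) =
      complexGaussianPDF s 1 y := by
  have h : Real.exp (-‖y - m‖ ^ 2 / v) *
      Real.exp (Real.log v - ‖y - s‖ ^ 2 + ‖y - m‖ ^ 2 / v) = v * Real.exp (-‖y - s‖ ^ 2) := by
    rw [← Real.exp_add, show -‖y - m‖ ^ 2 / v + (Real.log v - ‖y - s‖ ^ 2 + ‖y - m‖ ^ 2 / v) =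
      Real.log v + -‖y - s‖ ^ 2 by ring, Real.exp_add, Real.exp_log hv]
  rw [complexGaussianPDF, complexGaussianPDF, mul_assoc, h, div_one]
  field_simp

end Divergence

/-! ### Second moments of the noise -/

section Moments

lemma lintegral_norm_sq_stdComplexGaussian :
    ∫⁻ z, ENNReal.ofReal (‖z‖ ^ 2) ∂stdComplexGaussian = 1 := by
  have h := integral_norm_sq_complexGaussian 1
  rw [complexGaussian_one] at h
  rw [← ofReal_integral_eq_lintegral_ofReal
    ((complexGaussian_one ▸ memLp_norm_sq_complexGaussian 1).integrable (by simp))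
    (ae_of_all _ fun z => by positivity), h]
  simp

lemma lintegral_stdComplexGaussian_neg {F : ℂ → ℝ≥0∞} (hF : Measurable F) :
    ∫⁻ z, F (-z) ∂stdComplexGaussian = ∫⁻ z, F z ∂stdComplexGaussian := by
  have h := lintegral_stdComplexGaussian_add 0 hF
  have h' := lintegral_stdComplexGaussian_add 0 (hF.comp measurable_neg)
  simp only [zero_add, Function.comp_apply] at h h'
  rw [h, h', ← lintegral_neg_eq_self]
  simp [complexGaussianPDF]

/-- Averaging over z and -z and applying the parallelogram law removes the cross term, so the
computation stays in ℝ≥0∞. -/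
lemma lintegral_norm_add_sq_stdComplexGaussian (w : ℂ) :
    ∫⁻ z, ENNReal.ofReal (‖w + z‖ ^ 2) ∂stdComplexGaussian = ENNReal.ofReal (‖w‖ ^ 2) + 1 := by
  have hneg := lintegral_stdComplexGaussian_neg (F := fun z => ENNReal.ofReal (‖w + z‖ ^ 2))
    (by fun_prop)
  have hsum : ∫⁻ z, (ENNReal.ofReal (‖w + z‖ ^ 2) + ENNReal.ofReal (‖w + -z‖ ^ 2))
      ∂stdComplexGaussian = 2 * (ENNReal.ofReal (‖w‖ ^ 2) + 1) := by
    have : ∀ z : ℂ, ENNReal.ofReal (‖w + z‖ ^ 2) + ENNReal.ofReal (‖w + -z‖ ^ 2) =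
        2 * (ENNReal.ofReal (‖w‖ ^ 2) + ENNReal.ofReal (‖z‖ ^ 2)) := by
      intro z
      rw [← ENNReal.ofReal_add (by positivity) (by positivity),
        ← ENNReal.ofReal_add (by positivity) (by positivity),
        show (2 : ℝ≥0∞) = ENNReal.ofReal 2 by simp, ← ENNReal.ofReal_mul (by norm_num)]
      congr 1
      have := parallelogram_law_with_norm ℝ w z
      rw [← sub_eq_add_neg]
      nlinarith
    simp_rw [this]
    rw [lintegral_const_mul _ (by fun_prop), lintegral_add_left (by fun_prop),
      lintegral_norm_sq_stdComplexGaussian]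
    simp
  rw [lintegral_add_left (by fun_prop), hneg, ← two_mul] at hsum
  exact (ENNReal.mul_right_inj (by simp) (by simp)).1 hsum

end Moments

/-! ### Outputs with additive Gaussian noise -/

section GaussianNoise

variable {Ω β γ : Type*} [MeasurableSpace Ω] [MeasurableSpace β] [MeasurableSpace γ]

/-- Given (C, B), the true output is Gaussian with mean `f` and variance 1; under the reference law
it has mean `m C` and variance `v` whatever B is. The density is the quotient of these two Gaussian
densities. -/
lemma map_eq_withDensity_of_add_noise [StandardBorelSpace β] [Nonempty β] {μ : Measure Ω}
    [IsProbabilityMeasure μ] {B : Ω → β} {C : Ω → γ} {Z : Ω → ℂ} (hB : Measurable B)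
    (hC : Measurable C) (hZ : Measurable Z) {f : γ × β → ℂ} (hf : Measurable f)
    (hind : μ.map (fun ω => ((C ω, B ω), Z ω)) =
      (μ.map (fun ω => (C ω, B ω))).prod stdComplexGaussian)
    {m : γ → ℂ} (hm : Measurable m) {v : ℝ} (hv : 0 < v) :
    μ.map (fun ω => (C ω, f (C ω, B ω) + Z ω, B ω)) =
      ((μ.map C) ⊗ₘ (gaussianKernel m v ×ₖ condDistrib B C μ)).withDensity
        (fun p => ENNReal.ofReal (Real.exp (Real.log v - ‖p.2.1 - f (p.1, p.2.2)‖ ^ 2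
          + ‖p.2.1 - m p.1‖ ^ 2 / v))) := by
  have := isMarkovKernel_gaussianKernel hm hv
  have : IsProbabilityMeasure (μ.map C) := Measure.isProbabilityMeasure_map hC.aemeasurable
  refine Measure.ext_of_lintegral _ fun F hF => ?_
  set r : γ × ℂ × β → ℝ≥0∞ := fun p => ENNReal.ofReal (Real.exp (Real.log v
    - ‖p.2.1 - f (p.1, p.2.2)‖ ^ 2 + ‖p.2.1 - m p.1‖ ^ 2 / v)) with hr
  have hrm : Measurable r := by fun_prop
  have h1 : ∫⁻ p, F p ∂μ.map (fun ω => (C ω, f (C ω, B ω) + Z ω, B ω)) =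
      ∫⁻ c, ∫⁻ b, ∫⁻ y, F (c, y, b) * ENNReal.ofReal (complexGaussianPDF (f (c, b)) 1 y)
        ∂volume ∂condDistrib B C μ c ∂μ.map C := by
    have : μ.map (fun ω => (C ω, f (C ω, B ω) + Z ω, B ω)) =
        (μ.map (fun ω => ((C ω, B ω), Z ω))).map (fun q => (q.1.1, f q.1 + q.2, q.1.2)) := by
      rw [Measure.map_map (by fun_prop) (by fun_prop)]; rfl
    rw [this, hind, lintegral_map hF (by fun_prop), lintegral_prod _ (by fun_prop),
      ← compProd_map_condDistrib hB.aemeasurable, Measure.lintegral_compProd]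
    · refine lintegral_congr fun c => lintegral_congr fun b => ?_
      exact lintegral_stdComplexGaussian_add (f (c, b)) (F := fun y => F (c, y, b)) (by fun_prop)
    · exact Measurable.lintegral_prod_right' (f := fun q : (γ × β) × ℂ =>
        F (q.1.1, f q.1 + q.2, q.1.2)) (by fun_prop)
  rw [h1, lintegral_withDensity_eq_lintegral_mul _ hrm hF, Measure.lintegral_compProd (by fun_prop)]
  refine lintegral_congr fun c => ?_
  rw [Kernel.lintegral_prod _ _ _ (by fun_prop), lintegral_gaussianKernel hm v c
    (Measurable.lintegral_prod_right' (f := fun q : ℂ × β => (r * F) (c, q)) (by fun_prop))]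
  have h2 : ∀ y, ENNReal.ofReal (complexGaussianPDF (m c) v y) *
      ∫⁻ b, (r * F) (c, y, b) ∂condDistrib B C μ c =
      ∫⁻ b, F (c, y, b) * ENNReal.ofReal (complexGaussianPDF (f (c, b)) 1 y)
        ∂condDistrib B C μ c := by
    intro y
    rw [← lintegral_const_mul _ (by fun_prop)]
    refine lintegral_congr fun b => ?_
    rw [← complexGaussianPDF_one_eq_mul_exp (f (c, b)) (m c) y hv,
      ENNReal.ofReal_mul (complexGaussianPDF_pos _ hv _).le, Pi.mul_apply, hr]
    ring
  simp_rw [h2]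
  exact lintegral_lintegral_swap (by fun_prop)

/-- For an output `A = f(C, B) + Z` with Gaussian noise `Z` independent of `(C, B)`, estimating the
output from `C` by `m C` bounds the conditional mutual information. -/
lemma condMutualInfo_le_of_add_noise [StandardBorelSpace β] [Nonempty β] {μ : Measure Ω}
    [IsProbabilityMeasure μ] {B : Ω → β} {C : Ω → γ} {Z : Ω → ℂ} (hB : Measurable B)
    (hC : Measurable C) (hZ : Measurable Z) {f : γ × β → ℂ} (hf : Measurable f)
    (hind : μ.map (fun ω => ((C ω, B ω), Z ω)) =
      (μ.map (fun ω => (C ω, B ω))).prod stdComplexGaussian)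
    {m : γ → ℂ} (hm : Measurable m) {v S : ℝ} (hv : 0 < v) (hS : 0 ≤ S)
    (hSm : ∫⁻ ω, ENNReal.ofReal (‖f (C ω, B ω) - m (C ω)‖ ^ 2) ∂μ ≤ ENNReal.ofReal S) :
    condMutualInfo (fun ω => f (C ω, B ω) + Z ω) B C μ ≤
      ENNReal.ofReal ((Real.log v + (1 + S) / v - 1) / Real.log 2) := by
  have := isMarkovKernel_gaussianKernel hm hv
  have : IsProbabilityMeasure (μ.map C) := Measure.isProbabilityMeasure_map hC.aemeasurable
  have : IsProbabilityMeasure (μ.map (fun ω => (C ω, f (C ω, B ω) + Z ω, B ω))) :=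
    Measure.isProbabilityMeasure_map (by fun_prop)
  have : IsProbabilityMeasure (μ.map (fun ω => (C ω, B ω))) :=
    Measure.isProbabilityMeasure_map (by fun_prop)
  have hZlaw : μ.map Z = stdComplexGaussian := by
    have := congrArg Measure.snd hind
    rwa [Measure.snd_map_prodMk (by fun_prop), Measure.snd_prod] at this
  have hZ2 : ∫⁻ ω, ENNReal.ofReal (‖Z ω‖ ^ 2) ∂μ = 1 := by
    rw [← lintegral_norm_sq_stdComplexGaussian, ← hZlaw, lintegral_map (by fun_prop) hZ]
  have hD2 : ∫⁻ ω, ENNReal.ofReal (‖f (C ω, B ω) + Z ω - m (C ω)‖ ^ 2) ∂μ ≤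
      ENNReal.ofReal (1 + S) := by
    have h1 : ∫⁻ ω, ENNReal.ofReal (‖f (C ω, B ω) + Z ω - m (C ω)‖ ^ 2) ∂μ =
        ∫⁻ q, ENNReal.ofReal (‖f q.1 + q.2 - m q.1.1‖ ^ 2) ∂μ.map (fun ω => ((C ω, B ω), Z ω)) := by
      rw [lintegral_map (by fun_prop) (by fun_prop)]
    have h2 : ∀ (p : γ × β) (z : ℂ), f p + z - m p.1 = (f p - m p.1) + z := fun p z => by ring
    rw [h1, hind, lintegral_prod _ (by fun_prop)]
    simp_rw [h2, lintegral_norm_add_sq_stdComplexGaussian]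
    rw [lintegral_add_right _ measurable_const, lintegral_map (by fun_prop) (by fun_prop)]
    rw [lintegral_one, measure_univ, add_comm 1 S, ENNReal.ofReal_add hS zero_le_one,
      ENNReal.ofReal_one]
    gcongr
  have h_int : ∀ {g : Ω → ℝ}, Measurable g → (∀ ω, 0 ≤ g ω) →
      ∫⁻ ω, ENNReal.ofReal (g ω) ∂μ ≠ ∞ → Integrable g μ := by
    intro g hg h0 h
    refine ⟨hg.aestronglyMeasurable, ?_⟩
    rw [hasFiniteIntegral_iff_ofReal (ae_of_all _ h0)]
    exact h.lt_top
  have hiZ : Integrable (fun ω => ‖Z ω‖ ^ 2) μ :=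
    h_int (by fun_prop) (fun _ => by positivity) (hZ2 ▸ ENNReal.one_ne_top)
  have hiD : Integrable (fun ω => ‖f (C ω, B ω) + Z ω - m (C ω)‖ ^ 2) μ :=
    h_int (by fun_prop) (fun _ => by positivity) (ne_top_of_le_ne_top ENNReal.ofReal_ne_top hD2)
  have hZr : ∫ ω, ‖Z ω‖ ^ 2 ∂μ = 1 := by
    rw [integral_eq_lintegral_of_nonneg_ae (ae_of_all _ fun _ => by positivity)
      (by fun_prop), hZ2, ENNReal.toReal_one]
  have hDr : ∫ ω, ‖f (C ω, B ω) + Z ω - m (C ω)‖ ^ 2 ∂μ ≤ 1 + S := by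
    rw [integral_eq_lintegral_of_nonneg_ae (ae_of_all _ fun _ => by positivity) (by fun_prop)]
    exact ENNReal.toReal_le_of_le_ofReal (by positivity) hD2
  set l : γ × ℂ × β → ℝ := fun p => Real.log v - ‖p.2.1 - f (p.1, p.2.2)‖ ^ 2
    + ‖p.2.1 - m p.1‖ ^ 2 / v with hl
  have hlm : Measurable l := by fun_prop
  have hcomp : ∀ ω, l (C ω, f (C ω, B ω) + Z ω, B ω) =
      Real.log v - ‖Z ω‖ ^ 2 + ‖f (C ω, B ω) + Z ω - m (C ω)‖ ^ 2 / v := by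
    intro ω; simp [hl]
  have hil : Integrable l (μ.map (fun ω => (C ω, f (C ω, B ω) + Z ω, B ω))) := by
    rw [integrable_map_measure hlm.aestronglyMeasurable (by fun_prop)]
    exact (((integrable_const _).sub hiZ).add (hiD.div_const v)).congr
      (ae_of_all _ fun ω => (hcomp ω).symm)
  have hle := klDiv_condDistrib_le (A := fun ω => f (C ω, B ω) + Z ω) (by fun_prop) hB hC μ
    (gaussianKernel m v)
  rw [klDiv_withDensity_exp hlm (map_eq_withDensity_of_add_noise hB hC hZ hf hind hm hv) hil,
    integral_map (by fun_prop) hlm.aestronglyMeasurable] at hle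
  simp_rw [hcomp] at hle
  have hlog2 : 0 < Real.log 2 := Real.log_pos one_lt_two
  rw [condMutualInfo, ENNReal.ofReal_div_of_pos hlog2]
  refine ENNReal.div_le_div_right (hle.trans (ENNReal.ofReal_le_ofReal ?_)) _
  -- The mean log-ratio is log v - 1 + E|A - m(C)|²/v. Leaving `v` free costs nothing: v = 1 + S is
  -- the minimizer and turns the bound into log(1 + S).
  rw [integral_add (f := fun ω => Real.log v - ‖Z ω‖ ^ 2) ((integrable_const _).sub hiZ)
    (hiD.div_const v), integral_sub (integrable_const _) hiZ, integral_div, hZr]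
  simp only [integral_const, probReal_univ, smul_eq_mul, one_mul]
  have : (∫ ω, ‖f (C ω, B ω) + Z ω - m (C ω)‖ ^ 2 ∂μ) / v ≤ (1 + S) / v := by gcongr
  linarith

end GaussianNoise

/-! ### The outer bound -/

/-- The noise `Z_k` is independent of the inputs and of the other noises. -/
lemma map_inputNoiseLaw_noise (P : Measure (Fin 3 → ℂ)) [IsProbabilityMeasure P] (k : Fin 3)
    {δ : Type*} [MeasurableSpace δ] {T : (Fin 3 → ℂ) × (Fin 3 → ℂ) → δ}
    {G : (Fin 3 → ℂ) × (Fin 2 → ℂ) → δ} (hG : Measurable G)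
    (hT : ∀ ω, T ω = G (ω.1, fun j => ω.2 (k.succAbove j))) :
    (inputNoiseLaw P).map (fun ω => (T ω, ω.2 k)) =
      ((inputNoiseLaw P).map T).prod stdComplexGaussian := by
  have hsplit : (inputNoiseLaw P).map
      (fun ω => ((ω.1, fun j => ω.2 (k.succAbove j)), ω.2 k)) =
      (P.prod (Measure.pi fun _ : Fin 2 => stdComplexGaussian)).prod stdComplexGaussian := by
    refine Measure.ext_of_lintegral _ fun F hF => ?_
    rw [lintegral_map hF (by fun_prop), inputNoiseLaw, lintegral_prod _ (by fun_prop),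
      lintegral_prod _ (by fun_prop), lintegral_prod _ (by
        exact (Measurable.lintegral_prod_right' hF).aemeasurable)]
    refine lintegral_congr fun x => ?_
    have hp := measurePreserving_piFinSuccAbove (fun _ : Fin 3 => stdComplexGaussian) k
    have h := hp.lintegral_comp (f := fun q : ℂ × (Fin 2 → ℂ) => F ((x, q.2), q.1)) (by fun_prop)
    rw [lintegral_prod_symm _ (by fun_prop)] at h
    exact h
  have h1 : (inputNoiseLaw P).map (fun ω => (T ω, ω.2 k)) =
      ((inputNoiseLaw P).map
        (fun ω => ((ω.1, fun j => ω.2 (k.succAbove j)), ω.2 k))).map (Prod.map G id) := by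
    rw [Measure.map_map (by fun_prop) (by fun_prop)]
    congr 1
    ext1 ω
    simp [hT]
  have h2 : (inputNoiseLaw P).map T =
      (P.prod (Measure.pi fun _ : Fin 2 => stdComplexGaussian)).map G := by
    have hfst := congrArg Measure.fst hsplit
    rw [Measure.fst_map_prodMk (by fun_prop), Measure.fst_prod] at hfst
    rw [← hfst, Measure.map_map hG (by fun_prop)]
    congr 1
    ext1 ω
    exact hT ω
  rw [h1, hsplit, h2, ← Measure.map_prod_map _ _ hG measurable_id, Measure.map_id]

lemma lintegral_norm_sq_noise (P : Measure (Fin 3 → ℂ)) [IsProbabilityMeasure P] (k : Fin 3) :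
    ∫⁻ ω, ENNReal.ofReal (‖ω.2 k‖ ^ 2) ∂inputNoiseLaw P = 1 := by
  rw [inputNoiseLaw, lintegral_prod _ (by fun_prop)]
  have h : ∫⁻ z : Fin 3 → ℂ, ENNReal.ofReal (‖z k‖ ^ 2)
      ∂Measure.pi (fun _ => stdComplexGaussian) = 1 := by
    rw [← lintegral_norm_sq_stdComplexGaussian]
    exact (measurePreserving_eval (fun _ : Fin 3 => stdComplexGaussian) k).lintegral_comp
      (f := fun z => ENNReal.ofReal (‖z‖ ^ 2)) (by fun_prop)
  simp only [h, lintegral_one, measure_univ]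

/-- Cauchy–Schwarz with weights |a|, |b|, |c|. With unit powers the right side averages to at most
(|a| + |b| + |c|)², however the inputs are correlated. -/
lemma norm_add_three_sq_le (a b c x y z : ℂ) :
    ‖a * x + b * y + c * z‖ ^ 2 ≤
      (‖a‖ + ‖b‖ + ‖c‖) * (‖a‖ * ‖x‖ ^ 2 + ‖b‖ * ‖y‖ ^ 2 + ‖c‖ * ‖z‖ ^ 2) := by
  have h : ‖a * x + b * y + c * z‖ ≤ ‖a‖ * ‖x‖ + ‖b‖ * ‖y‖ + ‖c‖ * ‖z‖ := by
    simpa only [norm_mul] using norm_add₃_le (a := a * x) (b := b * y) (c := c * z)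
  have h2 := pow_le_pow_left₀ (norm_nonneg _) h 2
  have ha := norm_nonneg a
  have hb := norm_nonneg b
  have hc := norm_nonneg c
  nlinarith [mul_nonneg (mul_nonneg ha hb) (sq_nonneg (‖x‖ - ‖y‖)),
    mul_nonneg (mul_nonneg ha hc) (sq_nonneg (‖x‖ - ‖z‖)),
    mul_nonneg (mul_nonneg hb hc) (sq_nonneg (‖y‖ - ‖z‖))]

lemma lintegral_norm_sq_signal_le (P : Measure (Fin 3 → ℂ)) [IsProbabilityMeasure P]
    (hP : ∀ i, ∫⁻ x, ENNReal.ofReal (‖x i‖ ^ 2) ∂P ≤ 1) (a b c : ℂ) :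
    ∫⁻ ω, ENNReal.ofReal (‖a * ω.1 0 + b * ω.1 1 + c * ω.1 2‖ ^ 2) ∂inputNoiseLaw P ≤
      ENNReal.ofReal ((‖a‖ + ‖b‖ + ‖c‖) ^ 2) := by
  rw [inputNoiseLaw, lintegral_prod _ (by fun_prop)]
  simp only [lintegral_const, measure_univ, mul_one]
  calc ∫⁻ x : Fin 3 → ℂ, ENNReal.ofReal (‖a * x 0 + b * x 1 + c * x 2‖ ^ 2) ∂P
      ≤ ∫⁻ x : Fin 3 → ℂ, ENNReal.ofReal (‖a‖ + ‖b‖ + ‖c‖) *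
          (ENNReal.ofReal ‖a‖ * ENNReal.ofReal (‖x 0‖ ^ 2) +
            ENNReal.ofReal ‖b‖ * ENNReal.ofReal (‖x 1‖ ^ 2) +
            ENNReal.ofReal ‖c‖ * ENNReal.ofReal (‖x 2‖ ^ 2)) ∂P := by
        refine lintegral_mono fun x => ?_
        rw [← ENNReal.ofReal_mul (by positivity), ← ENNReal.ofReal_mul (by positivity),
          ← ENNReal.ofReal_mul (by positivity), ← ENNReal.ofReal_add (by positivity)
          (by positivity), ← ENNReal.ofReal_add (by positivity) (by positivity),
          ← ENNReal.ofReal_mul (by positivity)]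
        exact ENNReal.ofReal_le_ofReal (norm_add_three_sq_le _ _ _ _ _ _)
    _ = ENNReal.ofReal (‖a‖ + ‖b‖ + ‖c‖) *
          (ENNReal.ofReal ‖a‖ * ∫⁻ x, ENNReal.ofReal (‖x 0‖ ^ 2) ∂P +
            ENNReal.ofReal ‖b‖ * ∫⁻ x, ENNReal.ofReal (‖x 1‖ ^ 2) ∂P +
            ENNReal.ofReal ‖c‖ * ∫⁻ x, ENNReal.ofReal (‖x 2‖ ^ 2) ∂P) := by
        rw [lintegral_const_mul _ (by fun_prop), lintegral_add_left (by fun_prop),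
          lintegral_add_left (by fun_prop), lintegral_const_mul _ (by fun_prop),
          lintegral_const_mul _ (by fun_prop), lintegral_const_mul _ (by fun_prop)]
    _ ≤ ENNReal.ofReal (‖a‖ + ‖b‖ + ‖c‖) *
          (ENNReal.ofReal ‖a‖ * 1 + ENNReal.ofReal ‖b‖ * 1 + ENNReal.ofReal ‖c‖ * 1) := by
        gcongr <;> exact hP _
    _ = ENNReal.ofReal ((‖a‖ + ‖b‖ + ‖c‖) ^ 2) := by
        rw [mul_one, mul_one, mul_one, ← ENNReal.ofReal_add (by positivity) (by positivity),
          ← ENNReal.ofReal_add (by positivity) (by positivity),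
          ← ENNReal.ofReal_mul (by positivity), sq]

section Terms

variable (H : Matrix (Fin 3) (Fin 3) ℂ) (P : Measure (Fin 3 → ℂ)) [IsProbabilityMeasure P]

lemma mutualInfo_outputY_le (hP : ∀ i, ∫⁻ x, ENNReal.ofReal (‖x i‖ ^ 2) ∂P ≤ 1) (l : Fin 3) :
    mutualInfo (outputY H l) (fun ω => (inputX 0 ω, inputX 1 ω, inputX 2 ω)) (inputNoiseLaw P) ≤
      ENNReal.ofReal (Real.logb 2 (1 + (‖H l 0‖ + ‖H l 1‖ + ‖H l 2‖) ^ 2)) := by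
  set S := (‖H l 0‖ + ‖H l 1‖ + ‖H l 2‖) ^ 2 with hS
  have hS0 : 0 ≤ S := by positivity
  have hY : outputY H l = fun ω : (Fin 3 → ℂ) × (Fin 3 → ℂ) =>
      (fun q : Unit × ℂ × ℂ × ℂ => H l 0 * q.2.1 + H l 1 * q.2.2.1 + H l 2 * q.2.2.2)
        ((), inputX 0 ω, inputX 1 ω, inputX 2 ω) + ω.2 l := by
    ext ω; simp [outputY, inputX, Fin.sum_univ_three]
  have hXm : ∀ i, Measurable (inputX i) := fun i => by unfold inputX; fun_prop
  have hXm0 := hXm 0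
  have hXm1 := hXm 1
  have hXm2 := hXm 2
  refine (mutualInfo_le_condMutualInfo_const (by rw [hY]; fun_prop) (by fun_prop) _).trans ?_
  rw [hY]
  refine (condMutualInfo_le_of_add_noise
    (f := fun q : Unit × ℂ × ℂ × ℂ => H l 0 * q.2.1 + H l 1 * q.2.2.1 + H l 2 * q.2.2.2)
    (by fun_prop) (by fun_prop) (by fun_prop) (by fun_prop)
    (map_inputNoiseLaw_noise P l (G := fun q => ((), q.1 0, q.1 1, q.1 2)) (by fun_prop)
      (fun ω => rfl)) (m := fun _ => 0) (by fun_prop) (v := 1 + S) (by positivity) hS0 ?_).trans ?_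
  · simpa [inputX] using lintegral_norm_sq_signal_le P hP (H l 0) (H l 1) (H l 2)
  · rw [div_self (by positivity), add_sub_cancel_right]
    rfl

/-- With equal rows, Y₁ estimates the signal part of Y₂ with error Z₁, of variance S = 1. Then v = 1
+ S = 2, and log₂ 2 is one bit. -/
lemma condMutualInfo_outputY_one_le (h : ∀ i, H 1 i = H 0 i) :
    condMutualInfo (outputY H 1) (fun ω => (inputX 1 ω, inputX 2 ω))
      (fun ω => (inputX 0 ω, outputY H 0 ω)) (inputNoiseLaw P) ≤ 1 := by
  have hY : outputY H 1 = fun ω : (Fin 3 → ℂ) × (Fin 3 → ℂ) =>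
      (fun q : (ℂ × ℂ) × ℂ × ℂ => H 0 0 * q.1.1 + H 0 1 * q.2.1 + H 0 2 * q.2.2)
        ((inputX 0 ω, outputY H 0 ω), inputX 1 ω, inputX 2 ω) + ω.2 1 := by
    ext ω; simp [outputY, inputX, Fin.sum_univ_three, h]
  have hXm : ∀ i, Measurable (inputX i) := fun i => by unfold inputX; fun_prop
  have hXm0 := hXm 0
  have hXm1 := hXm 1
  have hXm2 := hXm 2
  have hYm : Measurable (outputY H 0) := by unfold outputY; fun_prop
  rw [hY]
  refine (condMutualInfo_le_of_add_noise
    (f := fun q : (ℂ × ℂ) × ℂ × ℂ => H 0 0 * q.1.1 + H 0 1 * q.2.1 + H 0 2 * q.2.2)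
    (by fun_prop) (by fun_prop) (by fun_prop) (by fun_prop)
    (map_inputNoiseLaw_noise P 1
      (G := fun q => ((q.1 0, ∑ i, H 0 i * q.1 i + q.2 0), q.1 1, q.1 2)) (by fun_prop)
      (fun ω => rfl)) (m := fun c => c.2) (by fun_prop) (v := 2) (S := 1) two_pos
      zero_le_one ?_).trans ?_
  · rw [ENNReal.ofReal_one, ← lintegral_norm_sq_noise P 0]
    refine lintegral_mono fun ω => le_of_eq ?_
    simp [Fin.sum_univ_three]
  · rw [← ENNReal.ofReal_one]
    refine ENNReal.ofReal_le_ofReal (le_of_eq ?_)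
    have := (Real.log_pos one_lt_two).ne'
    norm_num [this]

/-- Subtracting the known X₁ and X₂ from Y₁ leaves a noisy copy of X₃. Rescaled to the gain at the
third receiver, its error is `r` Z₁ with |r| ≤ 1, so S = 1 and v = 2 again give one bit. -/
lemma condMutualInfo_outputY_two_le (hne : H 0 2 ≠ 0) (hle : ‖H 2 2‖ ^ 2 ≤ ‖H 0 2‖ ^ 2) :
    condMutualInfo (outputY H 2) (inputX 2)
      (fun ω => (inputX 0 ω, inputX 1 ω, outputY H 0 ω, outputY H 1 ω)) (inputNoiseLaw P) ≤ 1 := by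
  have hY : outputY H 2 = fun ω : (Fin 3 → ℂ) × (Fin 3 → ℂ) =>
      (fun q : (ℂ × ℂ × ℂ × ℂ) × ℂ => H 2 0 * q.1.1 + H 2 1 * q.1.2.1 + H 2 2 * q.2)
        ((inputX 0 ω, inputX 1 ω, outputY H 0 ω, outputY H 1 ω), inputX 2 ω) + ω.2 2 := by
    ext ω; simp [outputY, inputX, Fin.sum_univ_three]
  have hXm : ∀ i, Measurable (inputX i) := fun i => by unfold inputX; fun_prop
  have hXm0 := hXm 0
  have hXm1 := hXm 1
  have hXm2 := hXm 2
  have hYm : ∀ i, Measurable (outputY H i) := fun i => by unfold outputY; fun_prop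
  have hYm0 := hYm 0
  have hYm1 := hYm 1
  rw [hY]
  set r : ℂ := H 2 2 / H 0 2 with hr
  have hr1 : ‖r‖ ^ 2 ≤ 1 := by
    rw [hr, norm_div, div_pow]
    exact div_le_one_of_le₀ hle (by positivity)
  refine (condMutualInfo_le_of_add_noise
    (f := fun q : (ℂ × ℂ × ℂ × ℂ) × ℂ => H 2 0 * q.1.1 + H 2 1 * q.1.2.1 + H 2 2 * q.2)
    (by fun_prop) (by fun_prop) (by fun_prop) (by fun_prop)
    (map_inputNoiseLaw_noise P 2
      (G := fun q => ((q.1 0, q.1 1, ∑ i, H 0 i * q.1 i + q.2 0, ∑ i, H 1 i * q.1 i + q.2 1),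
        q.1 2)) (by fun_prop) (fun ω => rfl))
      (m := fun c => H 2 0 * c.1 + H 2 1 * c.2.1 +
        r * (c.2.2.1 - H 0 0 * c.1 - H 0 1 * c.2.1)) (by fun_prop) (v := 2) (S := 1) two_pos
      zero_le_one ?_).trans ?_
  · rw [ENNReal.ofReal_one, ← lintegral_norm_sq_noise P 0]
    refine lintegral_mono fun ω => ENNReal.ofReal_le_ofReal ?_
    have : H 2 0 * inputX 0 ω + H 2 1 * inputX 1 ω + H 2 2 * inputX 2 ω -
        (H 2 0 * inputX 0 ω + H 2 1 * inputX 1 ω +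
          r * (outputY H 0 ω - H 0 0 * inputX 0 ω - H 0 1 * inputX 1 ω)) = - (r * ω.2 0) := by
      simp only [outputY, inputX, Fin.sum_univ_three, hr]
      field_simp
      ring
    change ‖H 2 0 * inputX 0 ω + H 2 1 * inputX 1 ω + H 2 2 * inputX 2 ω -
        (H 2 0 * inputX 0 ω + H 2 1 * inputX 1 ω +
          r * (outputY H 0 ω - H 0 0 * inputX 0 ω - H 0 1 * inputX 1 ω))‖ ^ 2 ≤ _
    rw [this, norm_neg, norm_mul, mul_pow]
    exact mul_le_of_le_one_left (by positivity) hr1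
  · rw [← ENNReal.ofReal_one]
    refine ENNReal.ofReal_le_ofReal (le_of_eq ?_)
    have := (Real.log_pos one_lt_two).ne'
    norm_num [this]

end Terms

lemma cmsSumCapacityOuterBound_le (H : Matrix (Fin 3) (Fin 3) ℂ) (h : ∀ i, H 1 i = H 0 i)
    (hne : H 0 2 ≠ 0) (hle : ‖H 2 2‖ ^ 2 ≤ ‖H 0 2‖ ^ 2) :
    cmsSumCapacityOuterBound H ≤
      ENNReal.ofReal (Real.logb 2 (1 + (‖H 0 0‖ + ‖H 0 1‖ + ‖H 0 2‖) ^ 2) + 2) := by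
  refine iSup_le fun P => iSup_le fun _ => iSup_le fun hP => ?_
  have hlog : 0 ≤ Real.logb 2 (1 + (‖H 0 0‖ + ‖H 0 1‖ + ‖H 0 2‖) ^ 2) :=
    Real.logb_nonneg one_lt_two (by nlinarith [sq_nonneg (‖H 0 0‖ + ‖H 0 1‖ + ‖H 0 2‖)])
  rw [ENNReal.ofReal_add hlog two_pos.le, show ENNReal.ofReal 2 = 1 + 1 by norm_num, ← add_assoc]
  exact add_le_add (add_le_add (mutualInfo_outputY_le H P hP 0)
    (condMutualInfo_outputY_one_le H P h)) (condMutualInfo_outputY_two_le H P hne hle)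

/-! ### Codes for the complex Gaussian channel -/

/-- A block of `n` independent complex Gaussian variables of variance `v`. -/
def gaussianBlock (n : ℕ) (v : ℝ≥0) : Measure (Fin n → ℂ) := Measure.pi fun _ => complexGaussian v

instance (n : ℕ) (v : ℝ≥0) : IsProbabilityMeasure (gaussianBlock n v) := by
  unfold gaussianBlock; infer_instance

lemma gaussianBlock_one (n : ℕ) : gaussianBlock n 1 = blockNoise n := rfl

instance (n : ℕ) : IsProbabilityMeasure (blockNoise n) := by
  unfold blockNoise; infer_instance

lemma lintegral_gaussianBlock_add (n : ℕ) (v w : ℝ≥0) {F : (Fin n → ℂ) → ℝ≥0∞}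
    (hF : Measurable F) :
    ∫⁻ x, ∫⁻ z, F (x + z) ∂gaussianBlock n w ∂gaussianBlock n v =
      ∫⁻ y, F y ∂gaussianBlock n (v + w) := by
  have h1 : ((complexGaussian v).prod (complexGaussian w)).map (fun q => q.1 + q.2) =
      complexGaussian (v + w) := by
    refine Measure.ext_of_lintegral _ fun f hf => ?_
    rw [lintegral_map hf (by fun_prop), lintegral_prod _ (by fun_prop),
      lintegral_complexGaussian_add _ _ hf]
  have : SigmaFinite (((complexGaussian v).prod (complexGaussian w)).map (fun q => q.1 + q.2)) := by
    rw [h1]; infer_instance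
  have h2 := Measure.pi_map_pi (ι := Fin n)
    (μ := fun _ => (complexGaussian v).prod (complexGaussian w)) (f := fun _ q => q.1 + q.2)
    (fun _ => by fun_prop)
  simp only [h1] at h2
  have h3 := (measurePreserving_arrowProdEquivProdArrow ℂ ℂ (Fin n)
    (fun _ => complexGaussian v) (fun _ => complexGaussian w)).lintegral_comp
    (f := fun q => F (q.1 + q.2)) (by fun_prop)
  rw [lintegral_prod _ (by fun_prop)] at h3
  rw [gaussianBlock, gaussianBlock, gaussianBlock, ← h3, ← h2, lintegral_map hF (by fun_prop)]
  rfl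

/-- Chebyshev's inequality for the energy of a Gaussian block. -/
lemma gaussianBlock_energy_deviation_le {n : ℕ} (hn : 0 < n) (v : ℝ≥0) {ε : ℝ} (hε : 0 < ε) :
    gaussianBlock n v {x | n * ε ≤ |∑ t, ‖x t‖ ^ 2 - n * v|} ≤
      ENNReal.ofReal (Var[fun z : ℂ => ‖z‖ ^ 2; complexGaussian v] / ε ^ 2 / n) := by
  have hmem : ∀ t : Fin n, MemLp (fun x : Fin n → ℂ => ‖x t‖ ^ 2) 2 (gaussianBlock n v) :=
    fun t => (memLp_norm_sq_complexGaussian v).comp_measurePreserving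
      (measurePreserving_eval (fun _ : Fin n => complexGaussian v) t)
  have hmean : ∫ x, ∑ t, ‖x t‖ ^ 2 ∂gaussianBlock n v = n * v := by
    rw [integral_finsetSum _ fun t _ => (hmem t).integrable (by simp)]
    have : ∀ t : Fin n, ∫ x, ‖x t‖ ^ 2 ∂gaussianBlock n v = v := fun t => by
      rw [← integral_norm_sq_complexGaussian v,
        ← (measurePreserving_eval (fun _ : Fin n => complexGaussian v) t).map_eq,
        integral_map (measurable_pi_apply t).aemeasurable (by fun_prop)]
      rfl
    simp [this]
  have hvar : Var[fun x => ∑ t, ‖x t‖ ^ 2; gaussianBlock n v] =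
      n * Var[fun z : ℂ => ‖z‖ ^ 2; complexGaussian v] := by
    have h := variance_sum_pi (μ := fun _ : Fin n => complexGaussian v)
      (X := fun _ z => ‖z‖ ^ 2) fun _ => memLp_norm_sq_complexGaussian v
    have h' : (∑ i : Fin n, fun ω : Fin n → ℂ => ‖ω i‖ ^ 2) = fun x => ∑ t, ‖x t‖ ^ 2 := by
      ext x; simp
    rw [h'] at h
    rw [gaussianBlock, h]
    simp
  have hn' : (0 : ℝ) < n := by exact_mod_cast hn
  have hmem' : MemLp (fun x : Fin n → ℂ => ∑ t, ‖x t‖ ^ 2) 2 (gaussianBlock n v) :=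
    memLp_finsetSum _ fun t _ => hmem t
  have h := meas_ge_le_variance_div_sq hmem' (c := n * ε) (by positivity)
  rw [hmean, hvar] at h
  refine h.trans (ENNReal.ofReal_le_ofReal (le_of_eq ?_))
  field_simp

/-- The output law gives small mass to the outputs of typical energy that are within noise
distance of a fixed codeword. -/
lemma gaussianBlock_typical_le (n : ℕ) {v : ℝ≥0} (hv : v ≠ 0) (ε : ℝ) (u : Fin n → ℂ) :
    gaussianBlock n v {y | ∑ t, ‖y t - u t‖ ^ 2 ≤ n * (1 + ε) ∧
        n * (v * (1 - ε)) ≤ ∑ t, ‖y t‖ ^ 2} ≤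
      ENNReal.ofReal ((Real.exp (2 * ε) / v) ^ n) := by
  have hv' : (0 : ℝ) < v := by exact_mod_cast pos_iff_ne_zero.2 hv
  -- Change of measure: `X t` is e^{2ε}/v times the ratio of the noise density around `u t` to the
  -- output density, so its mean is e^{2ε}/v. On the given set the product of the `X t` is at least
  -- 1, because its exponent is at least n(2ε + (1 - ε) - (1 + ε)) = 0.
  set X : Fin n → ℂ → ℝ≥0∞ := fun t y =>
    ENNReal.ofReal (Real.exp (2 * ε + ‖y‖ ^ 2 / v - ‖y - u t‖ ^ 2)) with hX
  have hXm : ∀ t, Measurable (X t) := fun t => by fun_prop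
  have hX1 : ∀ t, ∫⁻ y, X t y ∂complexGaussian v = ENNReal.ofReal (Real.exp (2 * ε) / v) := by
    intro t
    rw [complexGaussian_eq_withDensity hv, lintegral_withDensity_eq_lintegral_mul _ (by fun_prop)
      (hXm t)]
    have : ∀ y, ((fun z => ENNReal.ofReal (complexGaussianPDF 0 v z)) * X t) y =
        ENNReal.ofReal (Real.exp (2 * ε) / v) *
          ENNReal.ofReal (complexGaussianPDF (u t) 1 y) := by
      intro y
      rw [Pi.mul_apply, hX, ← ENNReal.ofReal_mul (complexGaussianPDF_pos _ hv' _).le,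
        ← ENNReal.ofReal_mul (by positivity)]
      congr 1
      have h : Real.exp (-‖y‖ ^ 2 / v) * Real.exp (2 * ε + ‖y‖ ^ 2 / v - ‖y - u t‖ ^ 2) =
          Real.exp (2 * ε) * Real.exp (-‖y - u t‖ ^ 2) := by
        rw [← Real.exp_add, ← Real.exp_add]
        congr 1
        ring
      rw [complexGaussianPDF, complexGaussianPDF, sub_zero, mul_assoc, h, div_one]
      field_simp
    simp_rw [this]
    rw [lintegral_const_mul _ (by fun_prop), lintegral_complexGaussianPDF _ one_pos, mul_one]
  have hprod : ∫⁻ y, ∏ t, X t (y t) ∂gaussianBlock n v =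
      ENNReal.ofReal ((Real.exp (2 * ε) / v) ^ n) := by
    rw [gaussianBlock, lintegral_prod_eq_prod_lintegral_of_indepFun _
      (fun t (y : Fin n → ℂ) => X t (y t)) (iIndepFun_pi fun t => (hXm t).aemeasurable)
      (fun t => (hXm t).comp (measurable_pi_apply t)), ENNReal.ofReal_pow (by positivity)]
    have : ∀ t : Fin n, ∫⁻ y, X t (y t) ∂Measure.pi (fun _ : Fin n => complexGaussian v) =
        ENNReal.ofReal (Real.exp (2 * ε) / v) := fun t => by
      rw [← hX1 t]
      exact (measurePreserving_eval (fun _ : Fin n => complexGaussian v) t).lintegral_comp (hXm t)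
    simp [this]
  have hA : MeasurableSet {y : Fin n → ℂ | ∑ t, ‖y t - u t‖ ^ 2 ≤ n * (1 + ε) ∧
      n * (v * (1 - ε)) ≤ ∑ t, ‖y t‖ ^ 2} := by measurability
  rw [← hprod, ← lintegral_indicator_one hA]
  refine lintegral_mono fun y => Set.indicator_le' (s := _) (f := 1)
    (g := fun y : Fin n → ℂ => ∏ t, X t (y t)) ?_ ?_ y
  · rintro y ⟨h1, h2⟩
    rw [Pi.one_apply, hX, ← ENNReal.ofReal_prod_of_nonneg fun t _ => (Real.exp_pos _).le,
      ← Real.exp_sum, ← ENNReal.ofReal_one]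
    refine ENNReal.ofReal_le_ofReal (Real.one_le_exp ?_)
    rw [Finset.sum_sub_distrib, Finset.sum_add_distrib, ← Finset.sum_div]
    have : n * (1 - ε) ≤ (∑ t, ‖y t‖ ^ 2) / v := by
      rw [le_div_iff₀ hv']; linarith
    simp only [Finset.sum_const, Finset.card_univ, Fintype.card_fin, nsmul_eq_mul]
    linarith
  · intro y _; exact zero_le

/-! ### Feinstein's maximal code construction -/

section Feinstein

variable {E : Type*} [AddCommGroup E] [MeasurableSpace E] [MeasurableAdd₂ E]

/-- One step of Feinstein's maximal code construction for an additive noise channel: as long as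
few codewords have been chosen, a further one can be decoded off the previous decoding regions. -/
lemma exists_codeword {μ ν Q : Measure E} [IsProbabilityMeasure μ] [IsProbabilityMeasure ν]
    (hQ : ∀ D, MeasurableSet D → ∫⁻ u, ν ((fun z => u + z) ⁻¹' D) ∂μ = Q D)
    {G T U D : Set E} (hG : MeasurableSet G) (hU : MeasurableSet U)
    (hD : MeasurableSet D) {δ : ℝ≥0∞} (hδ1 : δ ≤ 1) (hδ : μ Gᶜ + ν Tᶜ + Q Uᶜ + Q D < δ) :
    ∃ u ∈ G, ν ((fun z => u + z) ⁻¹' ({y | y - u ∈ T ∧ y ∈ U} \ D)ᶜ) ≤ δ := by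
  by_contra! hcon
  -- If every admissible `u` failed, this would hold pointwise (off `G` because δ ≤ 1), and
  -- averaging over `μ` would contradict `hδ`.
  have hpt : ∀ u, δ ≤ Gᶜ.indicator 1 u + (ν Tᶜ + (ν ((fun z => u + z) ⁻¹' Uᶜ) +
      ν ((fun z => u + z) ⁻¹' D))) := by
    intro u
    by_cases hu : u ∈ G
    · refine (hcon u hu).le.trans ?_
      have : (fun z => u + z) ⁻¹' ({y | y - u ∈ T ∧ y ∈ U} \ D)ᶜ ⊆
          Tᶜ ∪ ((fun z => u + z) ⁻¹' Uᶜ ∪ (fun z => u + z) ⁻¹' D) := by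
        intro z hz
        simp only [Set.mem_preimage, Set.mem_compl_iff, Set.mem_sdiff, Set.mem_ofPred_eq,
          add_sub_cancel_left, Set.mem_union] at hz ⊢
        tauto
      refine (measure_mono this).trans ((measure_union_le _ _).trans ?_)
      refine le_add_left (add_le_add le_rfl (measure_union_le _ _))
    · simp only [Set.indicator_of_mem (show u ∈ Gᶜ from hu), Pi.one_apply]
      exact hδ1.trans le_self_add
  have hm : ∀ D : Set E, MeasurableSet D → Measurable fun u => ν ((fun z => u + z) ⁻¹' D) :=
    fun D hD => measurable_measure_prodMk_left (s := (fun q : E × E => q.1 + q.2) ⁻¹' D)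
      (measurable_add hD)
  have hle := lintegral_mono (μ := μ) hpt
  rw [lintegral_const, measure_univ, mul_one,
    lintegral_add_left (measurable_one.indicator hG.compl), lintegral_indicator_one hG.compl,
    lintegral_add_left measurable_const, lintegral_const, measure_univ, mul_one,
    lintegral_add_left (hm _ hU.compl), hQ _ hU.compl, hQ _ hD, ← add_assoc, ← add_assoc] at hle
  exact absurd hδ (not_lt.2 hle)

/-- Feinstein's maximal code construction for an additive noise channel. -/
lemma exists_code_of_lt [MeasurableSub₂ E] {μ ν Q : Measure E} [IsProbabilityMeasure μ] [IsProbabilityMeasure ν]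
    (hQ : ∀ D, MeasurableSet D → ∫⁻ u, ν ((fun z => u + z) ⁻¹' D) ∂μ = Q D)
    {G T U : Set E} (hG : MeasurableSet G) (hT : MeasurableSet T) (hU : MeasurableSet U)
    {τ δ : ℝ≥0∞} (hτ : ∀ u, Q {y | y - u ∈ T ∧ y ∈ U} ≤ τ) (hδ1 : δ ≤ 1) {M : ℕ} (hM : 0 < M)
    (hδ : μ Gᶜ + ν Tᶜ + Q Uᶜ + M * τ < δ) :
    ∃ (x : Fin M → E) (dec : E → Fin M), Measurable dec ∧ (∀ w, x w ∈ G) ∧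
      ∀ w, ν {z | dec (x w + z) ≠ w} ≤ δ := by
  set A : E → Set E := fun u => {y | y - u ∈ T ∧ y ∈ U} with hAdef
  have hA : ∀ u, MeasurableSet (A u) := fun u =>
    ((measurable_id.sub_const u) hT).inter hU
  set D : (ℕ → E) → ℕ → Set E := fun x k => ⋃ j ∈ Finset.range k, A (x j) with hDdef
  have hD : ∀ x k, MeasurableSet (D x k) := fun x k =>
    Finset.measurableSet_biUnion _ fun j _ => hA _
  have hD_congr : ∀ {x x' : ℕ → E} {k : ℕ}, (∀ j < k, x j = x' j) → D x k = D x' k := by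
    intro x x' k h
    exact Set.iUnion₂_congr fun j hj => by rw [h j (Finset.mem_range.1 hj)]
  -- Codewords are chosen greedily. Region i depends only on codewords up to i, so later updates of
  -- the sequence do not disturb it.
  have hgreedy : ∀ k ≤ M, ∃ x : ℕ → E, ∀ i < k, x i ∈ G ∧
      ν ((fun z => x i + z) ⁻¹' (A (x i) \ D x i)ᶜ) ≤ δ := by
    intro k
    induction k with
    | zero => exact fun _ => ⟨fun _ => 0, fun i hi => absurd hi (Nat.not_lt_zero i)⟩
    | succ k ih =>
      intro hk
      obtain ⟨x, hx⟩ := ih (by omega)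
      have hQD : Q (D x k) ≤ M * τ := by
        refine (measure_biUnion_finset_le _ _).trans ((Finset.sum_le_card_nsmul _ _ τ
          fun j _ => hτ (x j)).trans ?_)
        rw [Finset.card_range, nsmul_eq_mul]
        gcongr
        omega
      obtain ⟨u, huG, hu⟩ := exists_codeword hQ hG hU (hD x k) hδ1
        ((add_le_add le_rfl hQD).trans_lt hδ)
      refine ⟨Function.update x k u, fun i hi => ?_⟩
      have hDi : D (Function.update x k u) i = D x i :=
        hD_congr fun j hj => Function.update_of_ne (by omega) _ _
      rw [hDi]
      rcases Nat.lt_succ_iff_lt_or_eq.1 hi with h | rfl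
      · rw [Function.update_of_ne h.ne]
        exact hx i h
      · rw [Function.update_self]
        exact ⟨huG, hu⟩
  obtain ⟨x, hx⟩ := hgreedy M le_rfl
  set B : Fin M → Set E := fun w => A (x w) \ D x w with hB
  have hBm : ∀ w, MeasurableSet (B w) := fun w => MeasurableSet.diff (hA _) (hD _ _)
  have hdisj : ∀ w w' : Fin M, w < w' → ∀ y ∈ B w, y ∉ B w' := by
    intro w w' h y hy hy'
    exact hy'.2 (Set.mem_biUnion (Finset.mem_coe.2 (Finset.mem_range.2 h)) hy.1)
  have huniq : ∀ {w w' : Fin M} {y : E}, y ∈ B w → y ∈ B w' → w = w' := by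
    intro w w' y hy hy'
    rcases lt_trichotomy w w' with h | h | h
    · exact absurd hy' (hdisj w w' h y hy)
    · exact h
    · exact absurd hy (hdisj w' w h y hy')
  classical
  -- Outputs outside all regions go to message 0, which is why the fibre computed below has a second
  -- piece.
  set dec : E → Fin M := fun y => if h : ∃ w, y ∈ B w then h.choose else ⟨0, hM⟩ with hdec
  have hdec_mem : ∀ {w y}, y ∈ B w → dec y = w := by
    intro w y hy
    have h : ∃ w, y ∈ B w := ⟨w, hy⟩
    rw [hdec]
    simp only [h, dite_true]
    exact huniq h.choose_spec hy
  refine ⟨fun w => x w, dec, measurable_to_countable' fun w => ?_, fun w => (hx w w.2).1,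
    fun w => (measure_mono fun z hz => ?_).trans (hx w w.2).2⟩
  · have : dec ⁻¹' {w} = B w ∪ ((⋃ w', B w')ᶜ ∩ {_y | (⟨0, hM⟩ : Fin M) = w}) := by
      ext y
      by_cases h : ∃ w', y ∈ B w'
      · obtain ⟨w', hw'⟩ := h
        have h1 : y ∉ (⋃ w', B w')ᶜ := fun h => h (Set.mem_iUnion.2 ⟨w', hw'⟩)
        simp only [Set.mem_preimage, Set.mem_singleton_iff, hdec_mem hw', Set.mem_union,
          Set.mem_inter_iff, h1, false_and, or_false]
        exact ⟨fun h => h ▸ hw', fun h => huniq hw' h⟩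
      · have h1 : y ∈ (⋃ w', B w')ᶜ := fun h' => h (Set.mem_iUnion.1 h')
        have h2 : y ∉ B w := fun h' => h ⟨w, h'⟩
        have h3 : dec y = ⟨0, hM⟩ := by rw [hdec]; simp only [h, dite_false]
        simp [h2, h3, -Set.compl_iUnion, h1]
    rw [this]
    exact (hBm w).union ((MeasurableSet.iUnion hBm).compl.inter (MeasurableSet.const _))
  · exact fun h => hz (hdec_mem h)

end Feinstein

/-- Rates below `log (1 + P)` are achievable on the complex Gaussian channel with power `P`. -/
lemma eventually_exists_gaussian_code {P R : ℝ} (hP : 0 < P) (hR : R < Real.log (1 + P))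
    {δ : ℝ} (hδ : 0 < δ) :
    ∀ᶠ n : ℕ in atTop, ∀ M : ℕ, 0 < M → (M : ℝ) ≤ Real.exp (R * n) →
      ∃ (x : Fin M → Fin n → ℂ) (dec : (Fin n → ℂ) → Fin M), Measurable dec ∧
        (∀ w, ∑ t, ‖x w t‖ ^ 2 ≤ n * P) ∧
        ∀ w, blockNoise n {z | dec (x w + z) ≠ w} ≤ ENNReal.ofReal δ := by
  -- Random codewords get a power slightly below `P`, so that by the law of large numbers most of
  -- them meet the energy limit.
  obtain ⟨p, hp0, hpP, hpR⟩ : ∃ p : ℝ, 0 < p ∧ p < P ∧ R < Real.log (1 + p) := by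
    have hc : ContinuousAt (fun p : ℝ => Real.log (1 + p)) P :=
      ContinuousAt.log (by fun_prop) (by positivity)
    have h1 : ∀ᶠ p in 𝓝[<] P, R < Real.log (1 + p) :=
      (hc.tendsto.mono_left nhdsWithin_le_nhds).eventually (lt_mem_nhds hR)
    have h2 : ∀ᶠ p in 𝓝[<] P, p ∈ Set.Ioo 0 P := Ioo_mem_nhdsLT hP
    obtain ⟨p, h1, h2⟩ := (h1.and h2).exists
    exact ⟨p, h2.1, h2.2, h1⟩
  lift p to ℝ≥0 using hp0.le
  set v : ℝ≥0 := p + 1 with hv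
  have hv0 : v ≠ 0 := by positivity
  have hvr : (v : ℝ) = 1 + p := by rw [hv]; push_cast; ring
  have hvpos : (0 : ℝ) < v := by rw [hvr]; positivity
  -- The typicality slack costs 2ε in the exponent, half of the rate gap, so log q = -(log(1 + p) -
  -- R)/2 < 0.
  set ε : ℝ := (Real.log (1 + p) - R) / 4 with hε
  have hε0 : 0 < ε := by rw [hε]; linarith
  set q : ℝ := Real.exp R * (Real.exp (2 * ε) / v) with hq
  have hq0 : 0 ≤ q := by positivity
  have hq1 : q < 1 := by
    rw [hq, ← mul_div_assoc, ← Real.exp_add, div_lt_one hvpos, ← Real.lt_log_iff_exp_lt hvpos, hvr]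
    linarith
  set K₁ : ℝ := Var[fun z : ℂ => ‖z‖ ^ 2; complexGaussian p] / (P - p) ^ 2
  set K₂ : ℝ := Var[fun z : ℂ => ‖z‖ ^ 2; complexGaussian 1] / ε ^ 2
  set K₃ : ℝ := Var[fun z : ℂ => ‖z‖ ^ 2; complexGaussian v] / (v * ε) ^ 2
  have hlim : Tendsto (fun n : ℕ => K₁ / n + K₂ / n + K₃ / n + q ^ n) atTop (𝓝 0) := by
    have h := fun K : ℝ => tendsto_const_div_atTop_nhds_zero_nat K
    simpa using (((h K₁).add (h K₂)).add (h K₃)).add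
      (tendsto_pow_atTop_nhds_zero_of_lt_one hq0 hq1)
  filter_upwards [hlim.eventually (gt_mem_nhds (lt_min hδ one_pos)), eventually_gt_atTop 0]
    with n hn hn0 M hM hMR
  have hnr : (0 : ℝ) < n := by exact_mod_cast hn0
  have hK : ∀ {w : ℝ≥0} {a : ℝ}, 0 ≤ Var[fun z : ℂ => ‖z‖ ^ 2; complexGaussian w] / a ^ 2 / n :=
    fun {w a} => div_nonneg (div_nonneg (variance_nonneg _ _) (sq_nonneg _)) hnr.le
  have hcode := exists_code_of_lt (μ := gaussianBlock n p) (ν := blockNoise n)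
    (Q := gaussianBlock n v) (G := {x | ∑ t, ‖x t‖ ^ 2 ≤ n * P})
    (T := {z | ∑ t, ‖z t‖ ^ 2 ≤ n * (1 + ε)}) (U := {y | n * (v * (1 - ε)) ≤ ∑ t, ‖y t‖ ^ 2})
    (τ := ENNReal.ofReal ((Real.exp (2 * ε) / v) ^ n)) (δ := ENNReal.ofReal (min δ 1))
    ?_ (by measurability) (by measurability) (by measurability)
    (fun u => gaussianBlock_typical_le n hv0 ε u)
    (ENNReal.ofReal_le_one.2 (min_le_right _ _)) hM ?_
  · obtain ⟨x, dec, hdec, hG, herr⟩ := hcode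
    exact ⟨x, dec, hdec, hG, fun w => (herr w).trans
      (ENNReal.ofReal_le_ofReal (min_le_left _ _))⟩
  · intro D hD
    have h := lintegral_gaussianBlock_add n p 1 (F := D.indicator 1) (measurable_one.indicator hD)
    rw [lintegral_indicator_one hD] at h
    rw [← hv, gaussianBlock_one] at h
    rw [← h]
    refine lintegral_congr fun u => ?_
    rw [← lintegral_indicator_one (measurable_const_add u hD)]
    rfl
  · have h1 : gaussianBlock n p {x | ∑ t, ‖x t‖ ^ 2 ≤ n * P}ᶜ ≤ ENNReal.ofReal (K₁ / n) := by
      refine (measure_mono fun x hx => ?_).trans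
        (gaussianBlock_energy_deviation_le hn0 p (sub_pos.2 hpP))
      simp only [Set.mem_compl_iff, Set.mem_ofPred_eq, not_le] at hx ⊢
      exact le_abs.2 (Or.inl (by linarith))
    have h2 : blockNoise n {z | ∑ t, ‖z t‖ ^ 2 ≤ n * (1 + ε)}ᶜ ≤ ENNReal.ofReal (K₂ / n) := by
      refine (measure_mono fun x hx => ?_).trans
        (gaussianBlock_energy_deviation_le hn0 1 hε0)
      simp only [Set.mem_compl_iff, Set.mem_ofPred_eq, not_le, NNReal.coe_one] at hx ⊢
      exact le_abs.2 (Or.inl (by linarith))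
    have h3 : gaussianBlock n v {y | n * (v * (1 - ε)) ≤ ∑ t, ‖y t‖ ^ 2}ᶜ ≤
        ENNReal.ofReal (K₃ / n) := by
      refine (measure_mono fun x hx => ?_).trans
        (gaussianBlock_energy_deviation_le hn0 v (mul_pos hvpos hε0))
      simp only [Set.mem_compl_iff, Set.mem_ofPred_eq, not_le] at hx ⊢
      exact le_abs.2 (Or.inr (by linarith))
    have h4 : (M : ℝ≥0∞) * ENNReal.ofReal ((Real.exp (2 * ε) / v) ^ n) ≤
        ENNReal.ofReal (q ^ n) := by
      rw [← ENNReal.ofReal_natCast, ← ENNReal.ofReal_mul (by positivity)]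
      refine ENNReal.ofReal_le_ofReal ?_
      rw [hq, mul_pow, ← Real.exp_nat_mul, mul_comm (n : ℝ) R]
      gcongr
    refine (add_le_add (add_le_add (add_le_add h1 h2) h3) h4).trans_lt ?_
    rw [← ENNReal.ofReal_add hK hK, ← ENNReal.ofReal_add (add_nonneg hK hK) hK,
      ← ENNReal.ofReal_add (add_nonneg (add_nonneg hK hK) hK) (by positivity)]
    exact (ENNReal.ofReal_lt_ofReal_iff (lt_min hδ one_pos)).2 hn

/-! ### Beamforming with time sharing -/

lemma sum_norm_sq_extend {m n : ℕ} (e : Fin m ↪ Fin n) (u : Fin m → ℂ) :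
    ∑ s, ‖Function.extend e u 0 s‖ ^ 2 = ∑ t, ‖u t‖ ^ 2 := by
  rw [← Finset.sum_subset (Finset.subset_univ (Finset.univ.map e)), Finset.sum_map]
  · exact Finset.sum_congr rfl fun t _ => by rw [e.injective.extend_apply]
  · intro s _ hs
    rw [Function.extend_apply']
    · simp
    · rintro ⟨t, rfl⟩
      exact hs (Finset.mem_map_of_mem e (Finset.mem_univ t))

lemma blockNoise_map_comp {m n : ℕ} (e : Fin m ↪ Fin n) :
    (blockNoise n).map (fun z => z ∘ e) = blockNoise m := by
  classical
  have hmeas : Measurable (fun z : Fin n → ℂ => z ∘ e) :=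
    measurable_pi_lambda _ fun t => measurable_pi_apply (e t)
  refine (Measure.pi_eq fun s hs => ?_).symm
  rw [Measure.map_apply hmeas (MeasurableSet.univ_pi hs)]
  have : (fun z : Fin n → ℂ => z ∘ e) ⁻¹' Set.univ.pi s =
      Set.univ.pi (Function.extend e s fun _ => Set.univ) := by
    ext z
    simp only [Set.mem_preimage, Set.mem_univ_pi, Function.comp_apply]
    constructor
    · intro h i
      by_cases hi : ∃ t, e t = i
      · obtain ⟨t, rfl⟩ := hi
        rw [e.injective.extend_apply]
        exact h t
      · rw [Function.extend_apply' _ _ _ hi]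
        trivial
    · intro h t
      have := h (e t)
      rwa [e.injective.extend_apply] at this
  rw [this, blockNoise, Measure.pi_pi,
    ← Finset.prod_subset (Finset.subset_univ (Finset.univ.map e)), Finset.prod_map]
  · exact Finset.prod_congr rfl fun t _ => by rw [e.injective.extend_apply]
  · intro i _ hi
    rw [Function.extend_apply', measure_univ]
    rintro ⟨t, rfl⟩
    exact hi (Finset.mem_map_of_mem e (Finset.mem_univ t))

/-- Transmitters 1 and 2 send amplified codewords of a point-to-point code in the disjoint sets of
time slots `e₁` and `e₂`; both receivers decode the two parts of the block separately. -/
def timeSharingCode {m N M : ℕ} (e₁ e₂ : Fin m ↪ Fin N) (κ : ℂ) (u : Fin M → Fin m → ℂ)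
    (dec : (Fin m → ℂ) → Fin M) (hdec : Measurable dec) : BeamformingCode N M M where
  enc₁ w := Function.extend e₁ (fun t => κ * u w t) 0
  enc₂ w := Function.extend e₂ (fun t => κ * u w t) 0
  dec₁ y := (dec fun t => y (e₁ t), dec fun t => y (e₂ t))
  dec₂ y := (dec fun t => y (e₁ t), dec fun t => y (e₂ t))
  measurable_dec₁ := by fun_prop
  measurable_dec₂ := by fun_prop

section TimeSharing

variable {m N M : ℕ} {e₁ e₂ : Fin m ↪ Fin N} {κ : ℂ} {u : Fin M → Fin m → ℂ}
  {dec : (Fin m → ℂ) → Fin M} {hdec : Measurable dec}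

/-- At most one primary transmitter is active in each slot, so the relay's energy is |a|² times the
sum of the two primary energies, each at most N. -/
lemma timeSharingCode_powerConstraint (he : ∀ s t, e₁ s ≠ e₂ t)
    (hu : ∀ w, ‖κ‖ ^ 2 * ∑ t, ‖u w t‖ ^ 2 ≤ N) {a : ℂ} (ha : ‖a‖ ^ 2 ≤ 1 / 2) :
    ((timeSharingCode e₁ e₂ κ u dec hdec).toIFCCR a a).PowerConstraint := by
  have henergy : ∀ (e : Fin m ↪ Fin N) (w : Fin M),
      ∑ t, ‖Function.extend e (fun t => κ * u w t) 0 t‖ ^ 2 ≤ N := by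
    intro e w
    rw [sum_norm_sq_extend]
    simp_rw [norm_mul, mul_pow]
    rw [← Finset.mul_sum]
    exact hu w
  have hpoint : ∀ (w₁ w₂ : Fin M) (t : Fin N),
      ‖a * Function.extend e₁ (fun t => κ * u w₁ t) 0 t +
        a * Function.extend e₂ (fun t => κ * u w₂ t) 0 t‖ ^ 2 ≤
      1 / 2 * (‖Function.extend e₁ (fun t => κ * u w₁ t) 0 t‖ ^ 2 +
        ‖Function.extend e₂ (fun t => κ * u w₂ t) 0 t‖ ^ 2) := by
    intro w₁ w₂ t
    rw [← mul_add, norm_mul, mul_pow]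
    refine mul_le_mul ha (le_of_eq ?_) (by positivity) (by norm_num)
    by_cases h : ∃ s, e₁ s = t
    · have h2 : ¬ ∃ s, e₂ s = t := by
        rintro ⟨s, hs⟩
        obtain ⟨s', hs'⟩ := h
        exact he s' s (hs'.trans hs.symm)
      simp [Function.extend_apply' _ _ _ h2]
    · simp [Function.extend_apply' _ _ _ h]
  have hmain : ∀ (i : Fin 3) (w₁ w₂ : Fin M), ∑ t, ‖((timeSharingCode e₁ e₂ κ u dec hdec).toIFCCR
      a a).input w₁ w₂ i t‖ ^ 2 ≤ N := by
    intro i w₁ w₂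
    fin_cases i
    · exact henergy e₁ w₁
    · exact henergy e₂ w₂
    · refine (Finset.sum_le_sum fun t _ => hpoint w₁ w₂ t).trans ?_
      rw [← Finset.mul_sum, Finset.sum_add_distrib]
      linarith [henergy e₁ w₁, henergy e₂ w₂]
  intro i
  calc ∑ w₁, ∑ w₂, ∑ t, ‖((timeSharingCode e₁ e₂ κ u dec hdec).toIFCCR a a).input w₁ w₂ i t‖ ^ 2
      ≤ ∑ _w₁ : Fin M, ∑ _w₂ : Fin M, (N : ℝ) :=
        Finset.sum_le_sum fun w₁ _ => Finset.sum_le_sum fun w₂ _ => hmain i w₁ w₂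
    _ = N * (M * M) := by simp; ring

variable {H : Matrix (Fin 3) (Fin 3) ℂ} {a : ℂ} {δ : ℝ}

/-- The effective gain through both paths is 1, so each half of the block is a clean use of the
point-to-point code, and a union bound over the halves gives 2δ. The two decoders of this code
coincide, so `dec₁` serves both receivers. -/
lemma timeSharingCode_pair_error_le (he : ∀ s t, e₁ s ≠ e₂ t) {l : Fin 3}
    (h0 : (H l 0 + H l 2 * a) * κ = 1) (h1 : (H l 1 + H l 2 * a) * κ = 1) (hδ : 0 ≤ δ)
    (herr : ∀ w, blockNoise m {z | dec (u w + z) ≠ w} ≤ ENNReal.ofReal δ) (w₁ w₂ : Fin M) :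
    (blockNoise N).real {z | (timeSharingCode e₁ e₂ κ u dec hdec).dec₁ (received H l
      (((timeSharingCode e₁ e₂ κ u dec hdec).toIFCCR a a).input w₁ w₂) z) ≠ (w₁, w₂)} ≤ 2 * δ := by
  have hrec₁ : ∀ z : Fin N → ℂ, (fun t => received H l
      (((timeSharingCode e₁ e₂ κ u dec hdec).toIFCCR a a).input w₁ w₂) z (e₁ t)) =
      u w₁ + z ∘ e₁ := by
    intro z
    ext t
    have h2 : ¬ ∃ s, e₂ s = e₁ t := fun ⟨s, hs⟩ => he t s hs.symm
    simp only [received, Fin.sum_univ_three, IFCCRCode.input, BeamformingCode.toIFCCR,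
      timeSharingCode, Matrix.cons_val_zero, Matrix.cons_val_one, Matrix.cons_val,
      e₁.injective.extend_apply, Function.extend_apply' _ _ _ h2, Pi.zero_apply, Pi.add_apply,
      Function.comp_apply]
    linear_combination u w₁ t * h0
  have hrec₂ : ∀ z : Fin N → ℂ, (fun t => received H l
      (((timeSharingCode e₁ e₂ κ u dec hdec).toIFCCR a a).input w₁ w₂) z (e₂ t)) =
      u w₂ + z ∘ e₂ := by
    intro z
    ext t
    have h2 : ¬ ∃ s, e₁ s = e₂ t := fun ⟨s, hs⟩ => he s t hs
    simp only [received, Fin.sum_univ_three, IFCCRCode.input, BeamformingCode.toIFCCR,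
      timeSharingCode, Matrix.cons_val_zero, Matrix.cons_val_one, Matrix.cons_val,
      e₂.injective.extend_apply, Function.extend_apply' _ _ _ h2, Pi.zero_apply, Pi.add_apply,
      Function.comp_apply]
    linear_combination u w₂ t * h1
  have hpart : ∀ (e : Fin m ↪ Fin N) (w : Fin M),
      blockNoise N {z | dec (u w + z ∘ e) ≠ w} ≤ ENNReal.ofReal δ := by
    intro e w
    refine le_trans (le_of_eq ?_) (herr w)
    have hme : Measurable (fun z : Fin N → ℂ => z ∘ e) :=
      measurable_pi_lambda _ fun t => measurable_pi_apply (e t)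
    have hset : MeasurableSet {z : Fin m → ℂ | dec (u w + z) ≠ w} :=
      (hdec.comp (measurable_const_add (u w))) (measurableSet_singleton w).compl
    rw [← blockNoise_map_comp e, Measure.map_apply hme hset]
    rfl
  refine ENNReal.toReal_le_of_le_ofReal (by positivity) ?_
  rw [two_mul, ENNReal.ofReal_add hδ hδ]
  refine (measure_mono ?_).trans ((measure_union_le _ _).trans
    (add_le_add (hpart e₁ w₁) (hpart e₂ w₂)))
  intro z hz
  by_contra hcon
  simp only [Set.mem_union, Set.mem_ofPred_eq, not_or, not_not] at hcon
  refine hz ?_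
  change (dec _, dec _) = _
  rw [hrec₁, hrec₂, hcon.1, hcon.2]

end TimeSharing

lemma average_le_of_le {M₁ M₂ : ℕ} {f : Fin M₁ → Fin M₂ → ℝ} {δ : ℝ} (hδ : 0 ≤ δ)
    (hf : ∀ i j, f i j ≤ δ) : (∑ i, ∑ j, f i j) / ((M₁ : ℝ) * M₂) ≤ δ := by
  refine div_le_of_le_mul₀ (by positivity) hδ ?_
  calc ∑ i, ∑ j, f i j ≤ ∑ _i : Fin M₁, ∑ _j : Fin M₂, δ :=
        Finset.sum_le_sum fun i _ => Finset.sum_le_sum fun j _ => hf i j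
    _ = δ * (M₁ * M₂) := by simp; ring

/-- Near-minimizers of `f n` on `S n` do as well as any δ-dependent choice, up to 1/(n + 1). This
diagonalizes over error levels while keeping the power constraint at every block length. -/
lemma exists_seq_tendsto_zero {C : ℕ → Type*} (S : ∀ n, Set (C n)) (f : ∀ n, C n → ℝ)
    (hf : ∀ n c, 0 ≤ f n c) (hS : ∀ n, (S n).Nonempty)
    (h : ∀ δ > 0, ∀ᶠ n in atTop, ∃ c ∈ S n, f n c ≤ δ) :
    ∃ c : ∀ n, C n, (∀ n, c n ∈ S n) ∧ Tendsto (fun n => f n (c n)) atTop (𝓝 0) := by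
  have hbdd : ∀ n, BddBelow (f n '' S n) := fun n => ⟨0, by rintro _ ⟨c, -, rfl⟩; exact hf n c⟩
  have hex : ∀ n : ℕ, ∃ c ∈ S n, f n c < sInf (f n '' S n) + 1 / ((n : ℝ) + 1) := by
    intro n
    obtain ⟨_, ⟨c, hc, rfl⟩, hlt⟩ := Real.lt_sInf_add_pos ((hS n).image (f n))
      (Nat.one_div_pos_of_nat (n := n) (α := ℝ))
    exact ⟨c, hc, hlt⟩
  choose c hcS hc using hex
  refine ⟨c, hcS, ?_⟩
  rw [Metric.tendsto_atTop']
  intro δ hδ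
  have hlim := tendsto_one_div_add_atTop_nhds_zero_nat (𝕜 := ℝ)
  obtain ⟨n₀, hn₀⟩ := eventually_atTop.1
    ((h (δ / 2) (half_pos hδ)).and (hlim.eventually (gt_mem_nhds (half_pos hδ))))
  refine ⟨n₀, fun n hn => ?_⟩
  obtain ⟨⟨c', hc'S, hc'⟩, hn'⟩ := hn₀ n hn.le
  have := csInf_le (hbdd n) ⟨c', hc'S, rfl⟩
  rw [Real.dist_0_eq_abs, abs_of_nonneg (hf _ _)]
  linarith [hc n]

lemma numMessages_pos (N : ℕ) (R : ℝ) : 0 < numMessages N R :=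
  Nat.ceil_pos.2 (Real.rpow_pos_of_pos two_pos _)

/-- Rate R/2 over N slots is rate R over the N/2 slots actually used. The strict gap to `R'`, which
is in nats, absorbs the ceiling and an odd N. -/
lemma eventually_numMessages_le {R R' : ℝ} (hR : 0 ≤ R) (hRR' : R * Real.log 2 < R') :
    ∀ᶠ N : ℕ in atTop, (numMessages N (R / 2) : ℝ) ≤ Real.exp (R' * (N / 2 : ℕ)) := by
  have hlim : Tendsto (fun N : ℕ => ((N / 2 : ℕ) : ℝ) * (R' - R * Real.log 2)) atTop atTop :=
    (tendsto_natCast_atTop_atTop.comp (Nat.tendsto_div_const_atTop two_ne_zero)).atTop_mul_const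
      (sub_pos.2 hRR')
  filter_upwards [hlim.eventually_ge_atTop ((1 + R / 2) * Real.log 2)] with N hN
  have hlog : 0 < Real.log 2 := Real.log_pos one_lt_two
  have hN2 : (N : ℝ) ≤ 2 * ((N / 2 : ℕ) : ℝ) + 1 := by
    exact_mod_cast (by omega : N ≤ 2 * (N / 2) + 1)
  have h1 : (1 : ℝ) ≤ (2 : ℝ) ^ ((N : ℝ) * (R / 2)) :=
    Real.one_le_rpow one_le_two (by positivity)
  have h2 : (numMessages N (R / 2) : ℝ) ≤ 2 * (2 : ℝ) ^ ((N : ℝ) * (R / 2)) := by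
    have := (Nat.ceil_lt_add_one (Real.rpow_nonneg two_pos.le ((N : ℝ) * (R / 2)))).le
    rw [numMessages]
    linarith
  refine h2.trans ?_
  rw [Real.rpow_def_of_pos two_pos]
  nth_rewrite 1 [← Real.exp_log two_pos]
  rw [← Real.exp_add]
  refine Real.exp_le_exp.2 ?_
  have h3 : (N : ℝ) * (R / 2) ≤ (2 * ((N / 2 : ℕ) : ℝ) + 1) * (R / 2) := by gcongr
  nlinarith [mul_le_mul_of_nonneg_left h3 hlog.le]

/-- Beamforming achieves every sum rate below `log₂ (1 + g²)`, `g = √2 d + |h_c|`, when all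
gains from the primary transmitters to the primary receivers are equal to `d`. -/
lemma beamformingAchievable_of_lt (H : Matrix (Fin 3) (Fin 3) ℂ) {d : ℝ} (hd : 0 ≤ d) {hc : ℂ}
    (hc_ne : hc ≠ 0) (h00 : H 0 0 = d) (h01 : H 0 1 = d) (h02 : H 0 2 = hc) (h10 : H 1 0 = d)
    (h11 : H 1 1 = d) (h12 : H 1 2 = hc) {R : ℝ} (hR : 0 ≤ R)
    (hRlt : R < Real.logb 2 (1 + (√2 * d + ‖hc‖) ^ 2)) :
    BeamformingAchievable H (R / 2) (R / 2) := by
  have hcpos : 0 < ‖hc‖ := norm_pos_iff.2 hc_ne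
  set g : ℝ := √2 * d + ‖hc‖ with hg
  have hgpos : 0 < g := by positivity
  have hs2 : √2 ^ 2 = (2 : ℝ) := Real.sq_sqrt two_pos.le
  have hs2c : ((√2 : ℝ) : ℂ) ^ 2 = 2 := by rw [← Complex.ofReal_pow, hs2]; simp
  have hs0 : ((√2 : ℝ) : ℂ) ≠ 0 := by
    exact_mod_cast (Real.sqrt_pos.2 two_pos).ne'
  -- The relay cancels the phase of `hc`, with |a|² = 1/2. The total gain is then d + |h_c|/√2 =
  -- g/√2, which `κ` inverts; energy (N/2) g² of the point-to-point code thus becomes transmitted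
  -- energy N.
  set a : ℂ := conj hc / (‖hc‖ * √2) with ha
  set κ : ℂ := ((√2 / g : ℝ) : ℂ) with hκ
  have hca : hc * a = ‖hc‖ / √2 := by
    have : hc * conj hc = (‖hc‖ : ℂ) ^ 2 := Complex.mul_conj' hc
    have hne : (‖hc‖ : ℂ) ≠ 0 := by exact_mod_cast hcpos.ne'
    rw [ha, ← mul_div_assoc, this]
    field_simp
  have hgain : ((d : ℂ) + hc * a) * κ = 1 := by
    have hgne : (g : ℂ) ≠ 0 := by exact_mod_cast hgpos.ne'
    have hgc : (g : ℂ) = (√2 : ℝ) * d + ‖hc‖ := by rw [hg]; push_cast; ring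
    rw [hca, hκ, Complex.ofReal_div]
    field_simp
    rw [hgc]
    ring
  have hanorm : ‖a‖ ^ 2 ≤ 1 / 2 := by
    rw [ha, norm_div, RCLike.norm_conj, norm_mul, Complex.norm_real, Complex.norm_real, norm_norm,
      Real.norm_of_nonneg (Real.sqrt_nonneg 2), div_pow, mul_pow, hs2]
    rw [div_le_div_iff₀ (by positivity) two_pos]
    linarith
  refine ⟨by positivity, by positivity, a, a, ?_⟩
  have hcodes := exists_seq_tendsto_zero
    (C := fun N => BeamformingCode N (numMessages N (R / 2)) (numMessages N (R / 2)))
    (fun N => {c | (c.toIFCCR a a).PowerConstraint})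
    (fun N c => max (c.jointError₁ H a a) (c.jointError₂ H a a)) ?_ ?_ ?_
  · exact hcodes
  · intro N c
    refine le_max_of_le_left ?_
    unfold BeamformingCode.jointError₁
    positivity
  · intro N
    -- The all-zero code satisfies the power constraint at every block length, including those where
    -- no good code is available yet.
    let w : Fin (numMessages N (R / 2)) := ⟨0, numMessages_pos _ _⟩
    refine ⟨⟨fun _ _ => 0, fun _ _ => 0, fun _ => (w, w), fun _ => (w, w), measurable_const,
      measurable_const⟩, fun i => ?_⟩
    have : ∀ w₁ w₂ t, ‖(BeamformingCode.toIFCCR (N := N) (M₁ := numMessages N (R / 2))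
        (M₂ := numMessages N (R / 2)) ⟨fun _ _ => 0, fun _ _ => 0, fun _ => (w, w),
        fun _ => (w, w), measurable_const, measurable_const⟩ a a).input w₁ w₂ i t‖ ^ 2 = 0 := by
      intro w₁ w₂ t
      fin_cases i <;> simp [IFCCRCode.input, BeamformingCode.toIFCCR]
    simp only [this, Finset.sum_const_zero]
    positivity
  · intro δ hδ
    obtain ⟨R', hR1, hR2⟩ : ∃ R', R * Real.log 2 < R' ∧ R' < Real.log (1 + g ^ 2) := by
      refine exists_between ?_
      rwa [Real.logb, lt_div_iff₀ (Real.log_pos one_lt_two)] at hRlt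
    have hp2p := (Nat.tendsto_div_const_atTop two_ne_zero).eventually
      (eventually_exists_gaussian_code (P := g ^ 2) (by positivity) hR2 (half_pos hδ))
    filter_upwards [hp2p, eventually_numMessages_le hR hR1] with N hN hM
    obtain ⟨u, dec, hdec, hpow, herr⟩ := hN _ (numMessages_pos N (R / 2)) hM
    have hN2 : 2 * (N / 2) ≤ N := by omega
    let e₁ : Fin (N / 2) ↪ Fin N := ⟨fun t => ⟨t, by omega⟩, fun s t h => by
      simpa [Fin.ext_iff] using h⟩
    let e₂ : Fin (N / 2) ↪ Fin N := ⟨fun t => ⟨N / 2 + t, by omega⟩, fun s t h => by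
      simpa [Fin.ext_iff] using h⟩
    have he : ∀ s t, e₁ s ≠ e₂ t := by
      intro s t h
      have h' : (s : ℕ) = N / 2 + t := congrArg Fin.val h
      have := s.2
      omega
    refine ⟨timeSharingCode e₁ e₂ κ u dec hdec, timeSharingCode_powerConstraint he (fun w => ?_)
      hanorm, max_le ?_ ?_⟩
    · have hκn : ‖κ‖ ^ 2 = 2 / g ^ 2 := by
        rw [hκ, Complex.norm_real, Real.norm_of_nonneg (by positivity), div_pow, hs2]
      rw [hκn]
      calc 2 / g ^ 2 * ∑ t, ‖u w t‖ ^ 2 ≤ 2 / g ^ 2 * ((N / 2 : ℕ) * g ^ 2) := by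
            gcongr; exact hpow w
        _ = ((2 * (N / 2) : ℕ) : ℝ) := by push_cast; field_simp
        _ ≤ N := by exact_mod_cast hN2
    · refine average_le_of_le hδ.le fun w₁ w₂ => ?_
      have := timeSharingCode_pair_error_le (H := H) (a := a) (l := 0) (hdec := hdec) he
        (by rw [h00, h02, hgain]) (by rw [h01, h02, hgain]) (half_pos hδ).le herr w₁ w₂
      linarith
    · refine average_le_of_le hδ.le fun w₁ w₂ => ?_
      have := timeSharingCode_pair_error_le (H := H) (a := a) (l := 1) (hdec := hdec) he
        (by rw [h10, h12, hgain]) (by rw [h11, h12, hgain]) (half_pos hδ).le herr w₁ w₂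
      exact this.trans (by linarith)

/-- A beamforming code with joint decoding is in particular a code with the message knowledge of
the interference channel with a cognitive relay. -/
lemma BeamformingAchievable.ifccrAchievable {H : Matrix (Fin 3) (Fin 3) ℂ} {R₁ R₂ : ℝ}
    (h : BeamformingAchievable H R₁ R₂) : IFCCRAchievable H R₁ R₂ := by
  obtain ⟨h1, h2, a, b, c, hpow, hlim⟩ := h
  refine ⟨h1, h2, fun N => (c N).toIFCCR a b, hpow, ?_⟩
  refine tendsto_of_tendsto_of_tendsto_of_le_of_le tendsto_const_nhds hlim (fun N => ?_)
    fun N => ?_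
  · refine le_max_of_le_left ?_
    unfold IFCCRCode.error₁
    positivity
  · refine max_le_max ?_ ?_
    · unfold IFCCRCode.error₁ BeamformingCode.jointError₁
      refine div_le_div_of_nonneg_right ?_ (by positivity)
      refine Finset.sum_le_sum fun w₁ _ => Finset.sum_le_sum fun w₂ _ => measureReal_mono ?_
      exact fun z hz h => hz (congrArg Prod.fst h)
    · unfold IFCCRCode.error₂ BeamformingCode.jointError₂
      refine div_le_div_of_nonneg_right ?_ (by positivity)
      refine Finset.sum_le_sum fun w₁ _ => Finset.sum_le_sum fun w₂ _ => measureReal_mono ?_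
      exact fun z hz h => hz (congrArg Prod.snd h)

/-! ### Consequence of the strong-interference condition -/

/-- X₃ is uncorrelated with X₁, and the part of X₂ left after removing X₁ is `w` X₃; ρ₁ supplies the
missing variance 1 - |w|². -/
lemma condCov_eq_vecMulVec {w : ℂ} (hw : ‖w‖ ≤ 1) :
    condCov ((√(1 - ‖w‖ ^ 2) : ℝ) : ℂ) 0 w = Matrix.vecMulVec ![w, 1] (star ![w, 1]) := by
  have h : (0 : ℝ) ≤ 1 - ‖w‖ ^ 2 := by nlinarith [norm_nonneg w]
  have h1 : (1 : ℂ) - (‖((√(1 - ‖w‖ ^ 2) : ℝ) : ℂ)‖ : ℂ) ^ 2 = w * conj w := by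
    rw [Complex.norm_real, Real.norm_of_nonneg (Real.sqrt_nonneg _), ← Complex.ofReal_pow,
      Real.sq_sqrt h, Complex.mul_conj']
    push_cast
    ring
  ext i j
  fin_cases i <;> fin_cases j <;> simp [condCov, Matrix.vecMulVec_apply]
  simpa using h1

lemma quadForm_vecMulVec (w u v : ℂ) :
    quadForm (Matrix.vecMulVec ![w, 1] (star ![w, 1])) u v = ‖u * w + v‖ ^ 2 := by
  rw [← Complex.normSq_eq_norm_sq, ← Complex.ofReal_re (Complex.normSq _), ← Complex.mul_conj,
    quadForm]
  congr 1
  simp [Matrix.mulVec, dotProduct, Matrix.vecMulVec_apply, Fin.sum_univ_two]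
  ring

lemma StrongInterference.norm_sq_le {hd hi hc : ℂ} (h : StrongInterference hd hi hc) {w : ℂ}
    (hw : ‖w‖ ≤ 1) : ‖(‖hd‖ : ℂ) * w + hc‖ ^ 2 ≤ ‖hi * w + hc‖ ^ 2 := by
  have h0 : (0 : ℝ) ≤ 1 - ‖w‖ ^ 2 := by nlinarith [norm_nonneg w]
  have hρ : ‖((√(1 - ‖w‖ ^ 2) : ℝ) : ℂ)‖ ≤ 1 := by
    rw [Complex.norm_real, Real.norm_of_nonneg (Real.sqrt_nonneg _)]
    exact Real.sqrt_le_one.2 (by nlinarith [sq_nonneg ‖w‖])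
  have hlog := h _ 0 w hρ (by simp) hw (by
    rw [condCov_eq_vecMulVec hw]
    exact Matrix.posSemidef_vecMulVec_self_star _)
  rw [condCov_eq_vecMulVec hw, quadForm_vecMulVec, quadForm_vecMulVec,
    Real.logb_le_logb one_lt_two (by positivity) (by positivity)] at hlog
  linarith

/-- Correlations `ρ₁ → 1` make the cross terms in the strong-interference condition dominate, so
that it can only hold if the cross gain equals the direct gain. -/
lemma StrongInterference.eq {hd hi hc : ℂ} (h : StrongInterference hd hi hc) (hc_ne : hc ≠ 0) :
    hi = ‖hd‖ := by
  by_contra hne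
  set D : ℂ := hi - ‖hd‖ with hD
  have hD0 : 0 < ‖D‖ := norm_pos_iff.2 (sub_ne_zero.2 hne)
  have hc0 : 0 < ‖hc‖ := norm_pos_iff.2 hc_ne
  -- The direction of `w` makes the difference of the linear terms equal to 2L with L = s
  -- |h_c|²|D|². The step `s` ensures |w| ≤ 1 and s|h_i|² ≤ 1, so the quadratic gain is at most L,
  -- whereas the condition would require it to be at least 2L > 0.
  set s : ℝ := 1 / (1 + ‖D‖ * ‖hc‖ + ‖hi‖ ^ 2) with hs
  have hs0 : 0 < s := by positivity
  have hden : s * (1 + ‖D‖ * ‖hc‖ + ‖hi‖ ^ 2) = 1 := by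
    rw [hs]; field_simp
  set w : ℂ := -(s * (conj D * hc)) with hw
  have hwn : ‖w‖ = s * (‖D‖ * ‖hc‖) := by
    rw [hw, norm_neg, norm_mul, norm_mul, RCLike.norm_conj, Complex.norm_real,
      Real.norm_of_nonneg hs0.le]
  have hle := h.norm_sq_le (w := w) (by
    rw [hwn]
    nlinarith [mul_nonneg hs0.le (sq_nonneg ‖hi‖)])
  have hexp : ∀ x : ℂ, ‖x * w + hc‖ ^ 2 =
      ‖x‖ ^ 2 * ‖w‖ ^ 2 + ‖hc‖ ^ 2 - 2 * (s * (‖hc‖ ^ 2 * (x * conj D).re)) := by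
    intro x
    have h1 : (x * w * conj hc).re = -(s * (‖hc‖ ^ 2 * (x * conj D).re)) := by
      have : x * w * conj hc = -((s : ℂ) * (((‖hc‖ ^ 2 : ℝ) : ℂ) * (x * conj D))) := by
        rw [hw, Complex.ofReal_pow, ← Complex.mul_conj' hc]
        ring
      rw [this, Complex.neg_re, Complex.re_ofReal_mul, Complex.re_ofReal_mul]
    rw [← Complex.normSq_eq_norm_sq, Complex.normSq_add, Complex.normSq_eq_norm_sq,
      Complex.normSq_eq_norm_sq, norm_mul, mul_pow, h1]
    ring
  rw [hexp, hexp] at hle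
  have hre : (hi * conj D).re - ((‖hd‖ : ℂ) * conj D).re = ‖D‖ ^ 2 := by
    rw [← Complex.sub_re, ← sub_mul, ← hD, Complex.mul_conj', ← Complex.ofReal_pow,
      Complex.ofReal_re]
  have hw2 : ‖w‖ ^ 2 = s ^ 2 * (‖D‖ ^ 2 * ‖hc‖ ^ 2) := by rw [hwn]; ring
  have hmain : 2 * (s * (‖hc‖ ^ 2 * ‖D‖ ^ 2)) ≤ ‖hi‖ ^ 2 * (s ^ 2 * (‖D‖ ^ 2 * ‖hc‖ ^ 2)) := by
    have h3 : 0 ≤ ‖(‖hd‖ : ℂ)‖ ^ 2 * ‖w‖ ^ 2 := by positivity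
    rw [← hw2, ← hre]
    nlinarith
  have hsi : s * ‖hi‖ ^ 2 ≤ 1 := by nlinarith [mul_pos hs0 (mul_pos hD0 hc0)]
  have hpos : 0 < s * (‖hc‖ ^ 2 * ‖D‖ ^ 2) := by positivity
  nlinarith [mul_le_mul_of_nonneg_right hsi hpos.le]

end CIFC

end

/-! ### The three-bit gap -/

theorem mainTheorem4 (hd hi hc h31 h32 h33 : ℂ) (hc_ne : hc ≠ 0)
    (h33_le : ‖h33‖ ^ 2 ≤ ‖hc‖ ^ 2) (hstrong : CIFC.StrongInterference hd hi hc) :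
    ∃ R₁ R₂ : ℝ,
      CIFC.IFCCRAchievable (CIFC.symmetricGains hd hi hc h31 h32 h33) R₁ R₂ ∧
      CIFC.BeamformingAchievable (CIFC.symmetricGains hd hi hc h31 h32 h33) R₁ R₂ ∧
      CIFC.cmsSumCapacityOuterBound (CIFC.symmetricGains hd hi hc h31 h32 h33) ≤
        ENNReal.ofReal (R₁ + R₂ + 3) := by
  have hhi := hstrong.eq hc_ne
  subst hhi
  set d : ℝ := ‖hd‖ with hd_def
  have hd0 : 0 ≤ d := norm_nonneg _
  have hc0 : 0 < ‖hc‖ := norm_pos_iff.2 hc_ne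
  -- The bound on the first term of the converse, less one bit; the maximum with 0 keeps the rates
  -- nonnegative when that is negative.
  set R : ℝ := max 0 (Real.logb 2 ((1 + (2 * d + ‖hc‖) ^ 2) / 2)) with hR
  have hs2 : √2 ^ 2 = (2 : ℝ) := Real.sq_sqrt two_pos.le
  have hs1 : 1 ≤ √2 := Real.one_le_sqrt.2 one_le_two
  have hRlt : R < Real.logb 2 (1 + (√2 * d + ‖hc‖) ^ 2) := by
    refine max_lt (Real.logb_pos one_lt_two (lt_add_of_pos_right _ (by positivity))) ?_
    refine Real.logb_lt_logb one_lt_two (by positivity) ?_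
    -- With c = |h_c|, compare 1 + 4d² + 4dc + c² with 2 + 4d² + 4√2 dc + 2c². The inequality is
    -- strict, as achievability is available only strictly below the logarithm.
    nlinarith [mul_nonneg hd0 hc0.le, mul_nonneg (sub_nonneg.2 hs1) (mul_nonneg hd0 hc0.le),
      sq_nonneg d]
  have hbeam : CIFC.BeamformingAchievable
      (CIFC.symmetricGains hd d hc h31 h32 h33) (R / 2) (R / 2) :=
    CIFC.beamformingAchievable_of_lt _ hd0 hc_ne rfl rfl rfl rfl rfl rfl (le_max_left _ _) hRlt
  refine ⟨R / 2, R / 2, hbeam.ifccrAchievable, hbeam, ?_⟩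
  refine (CIFC.cmsSumCapacityOuterBound_le _ (fun i => ?_) hc_ne h33_le).trans
    (ENNReal.ofReal_le_ofReal ?_)
  · fin_cases i <;> simp [CIFC.symmetricGains, hd_def]
  · have hsum : ‖CIFC.symmetricGains hd d hc h31 h32 h33 0 0‖ +
        ‖CIFC.symmetricGains hd d hc h31 h32 h33 0 1‖ +
        ‖CIFC.symmetricGains hd d hc h31 h32 h33 0 2‖ = 2 * d + ‖hc‖ := by
      simp [CIFC.symmetricGains, hd_def]
      ring
    have hlog : Real.logb 2 ((1 + (2 * d + ‖hc‖) ^ 2) / 2) =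
        Real.logb 2 (1 + (2 * d + ‖hc‖) ^ 2) - 1 := by
      rw [Real.logb_div (by positivity) two_ne_zero, Real.logb_self_eq_one one_lt_two]
    have := le_max_right 0 (Real.logb 2 ((1 + (2 * d + ‖hc‖) ^ 2) / 2))
    rw [hsum]
    linarith
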